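/- Let $H$ be a separable infinite-dimensional complex Hilbert space, $B(H)$ the algebra of bounded linear operators on $H$, and $J$ a two-sided ideal of $B(H)$ (a "$B(H)$-ideal"). A $J$-ideal is an additive subgroup $I$ of $J$ with $AX, XA\in I$ for all $A\in J$, $X\in I$; it is linear (real linear) if it is also closed under multiplication by complex (real) scalars. Let $\mathscr S=\{S_1,\dots,S_N\}\subseteq J$, and let $(\mathscr S)$, $(\mathscr S)_J$, $\langle\mathscr S\rangle_J$, $(\mathscr S)_J^{\mathbb R}$ denote, respectively, the smallest $B(H)$-ideal, linear $J$-ideal, $J$-ideal, and real linear $J$-ideal containing $\mathscr S$. The product $IK$ of two $B(H)$-ideals is the set of all finite sums of products $XY$ with $X\in I$, $Y\in K$. For $T\in B(H)$ put $|T|=(T^*T)^{1/2}$ and let $s(T)=(s_n(T))_{n\ge1}$ be its sequence of s-numbers, $s_n(T)=\inf\{\|T-F\| : F\in B(H),\ \operatorname{rank}F<n\}$. For a sequence $\xi$ and an integer $m\ge1$, $D_m\xi=(\xi_1,\dots,\xi_1,\xi_2,\dots,\xi_2,\dots)$ is the sequence in which each entry of $\xi$ is repeated $m$ times; products of sequences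 are pointwise. The following are equivalent. 1. Any of $(\mathscr S)_J$, $\langle\mathscr S\rangle_J$, $(\mathscr S)_J^{\mathbb R}$ is a $B(H)$-ideal (that is, for each of the three separately, the condition that it is a $B(H)$-ideal is equivalent to the conditions below). 2. $(\mathscr S)$ is $J$-soft, i.e. $(\mathscr S)=J(\mathscr S)$; equivalently, $(\mathscr S)=(\mathscr S)J$. 3. For every $1\le j\le N$, $S_j=\sum_{k=1}^N\sum_{i=1}^{n_{k}}A_{ki}S_kB_{ki}$ for some finite numbers $n_k$ and some $A_{ki},B_{ki}\in J$ (all depending on $j$). 4. For every $1\le j\le N$, $s(S_j)=O\big(D_m(s(|S_1|+\cdots+|S_N|))\,s(T)\big)$ for some $T\in J$ and some integer $m\ge1$; equivalently, this holds for all $j$ with one common $T$ and $m$. If any one of the three $J$-ideals in 1 is a $B(H)$-ideal, then $$\langle\mathscr S\rangle_J=(\mathscr S)_J^{\mathbb R}=(\mathscr S)_J=(\mathscr S)=(|S_1|+\cdots+|S_N|),$$ where the last term is the $B(H)$-ideal generated by the single operator $|S_1|+\cdots+|S_N|$. -/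

import Mathlib

open Filter Asymptotics

namespace Subideal

/-- The algebra `B(H)` of bounded linear operators. -/
abbrev BH (H : Type*) [NormedAddCommGroup H] [InnerProductSpace ℂ H] : Type _ := H →L[ℂ] H

section Ring

variable {R : Type*} [Ring R]

/-- The product `I K` of two-sided ideals: all finite sums of products `a * b` with
`a ∈ I` and `b ∈ K` (the set of these products is closed under negation). -/
def idealMul (I K : TwoSidedIdeal R) : TwoSidedIdeal R :=
  TwoSidedIdeal.mk' (AddSubgroup.closure {x : R | ∃ a ∈ I, ∃ b ∈ K, x = a * b} : Set R)
    (AddSubgroup.zero_mem _)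
    (fun hx hy => AddSubgroup.add_mem _ hx hy)
    (fun hx => AddSubgroup.neg_mem _ hx)
    (by
      intro x y hy
      refine AddSubgroup.closure_induction (p := fun y _ => x * y ∈ AddSubgroup.closure
        {x : R | ∃ a ∈ I, ∃ b ∈ K, x = a * b}) ?_ ?_ ?_ ?_ hy
      · rintro _ ⟨a, ha, b, hb, rfl⟩
        exact AddSubgroup.subset_closure
          ⟨x * a, I.mul_mem_left x a ha, b, hb, (mul_assoc x a b).symm⟩
      · rw [mul_zero]; exact AddSubgroup.zero_mem _
      · intro u v _ _ hu hv; rw [mul_add]; exact AddSubgroup.add_mem _ hu hv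
      · intro u _ hu; rw [mul_neg]; exact AddSubgroup.neg_mem _ hu)
    (by
      intro y x hy
      refine AddSubgroup.closure_induction (p := fun y _ => y * x ∈ AddSubgroup.closure
        {x : R | ∃ a ∈ I, ∃ b ∈ K, x = a * b}) ?_ ?_ ?_ ?_ hy
      · rintro _ ⟨a, ha, b, hb, rfl⟩
        exact AddSubgroup.subset_closure
          ⟨a, ha, b * x, K.mul_mem_right b x hb, mul_assoc a b x⟩
      · rw [zero_mul]; exact AddSubgroup.zero_mem _
      · intro u v _ _ hu hv; rw [add_mul]; exact AddSubgroup.add_mem _ hu hv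
      · intro u _ hu; rw [neg_mul]; exact AddSubgroup.neg_mem _ hu)

/-- `I` is a `J`-ideal: an additive subgroup of `J` that is closed under left and right
multiplication by elements of `J` (no linearity is required). -/
structure IsJIdeal (J : TwoSidedIdeal R) (I : AddSubgroup R) : Prop where
  subset : ∀ x ∈ I, x ∈ J
  mul_left : ∀ a ∈ J, ∀ x ∈ I, a * x ∈ I
  mul_right : ∀ a ∈ J, ∀ x ∈ I, x * a ∈ I

/-- The additive subgroup `I` is (the underlying subgroup of) a two-sided ideal of the whole
ring. -/
def IsFullIdeal (I : AddSubgroup R) : Prop :=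
  ∃ K : TwoSidedIdeal R, (K : Set R) = (I : Set R)

/-- The smallest `J`-ideal containing `s`. -/
def jSpan (J : TwoSidedIdeal R) (s : Set R) : AddSubgroup R :=
  sInf {I | IsJIdeal J I ∧ s ⊆ (I : Set R)}

/-- The smallest `J`-ideal containing `s` that is closed under multiplication by scalars
from `𝕜`. -/
def jSpanOver (𝕜 : Type*) [SMul 𝕜 R] (J : TwoSidedIdeal R) (s : Set R) : AddSubgroup R :=
  sInf {I | IsJIdeal J I ∧ (∀ c : 𝕜, ∀ x ∈ I, c • x ∈ I) ∧ s ⊆ (I : Set R)}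

end Ring

section Operators

variable {H : Type*} [NormedAddCommGroup H] [InnerProductSpace ℂ H]

/-- The s-numbers (singular numbers) of a bounded operator, indexed from `0`: `sNum T n` is the
distance of `T` from the operators of rank at most `n`. -/
noncomputable def sNum (T : BH H) (n : ℕ) : ℝ :=
  ⨅ F : {F : BH H // LinearMap.rank (F : H →ₗ[ℂ] H) ≤ (n : Cardinal)}, ‖T - F.1‖

end Operators

/-- The `m`-fold ampliation of a sequence (indexed from `0`): each entry is repeated `m` times. -/
def ampliation (m : ℕ) (ξ : ℕ → ℝ) (n : ℕ) : ℝ := ξ (n / m)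

end Subideal

namespace Subideal

/-! ### Products of ideals and generated J-ideals -/

section Ring

variable {R : Type*} [Ring R]

/-! Write `I` for the `B(H)`-ideal generated by the `S j`. Everything passes through softness, `I =
J I`.

If one of the three generated J-ideals is a `B(H)`-ideal, it contains `I` and lies in the linear
J-ideal `span S + J I`. So `I / J I` is a finite-dimensional left `B(H)`-module. Two isometries with
orthogonal ranges cannot act on a nonzero finite-dimensional space, hence `I = J I`
(`ideal_le_of_finite_codim`, `span_le_idealMul_of_isFullIdeal`). Ideals of `B(H)` are self-adjoint,
so `J I = I J`. Softness then gives `I = J I J`, whose elements are sums of terms `A * S k * B`.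
Conversely, in such a sum arbitrary outer multipliers are absorbed into `A, B ∈ J`, which puts `I`
inside the smallest J-ideal and collapses all the generated ideals (`jSpan_eq_of_sandwich`).

The s-number condition uses Calkin's correspondence: an operator and the diagonal operator of its
s-numbers lie in the same ideals (`diagMem_sNum`, `mem_of_diagMem_sNum`). Since `I` is generated by
`K = ∑ |S k|`, the inequalities for s-numbers of sums and products bound elements of `J I` by
ampliations of `s(K)` times a sequence from `J`. Products of diagonal operators give the converse.
-/

theorem mul_mem_idealMul {I K : TwoSidedIdeal R} {a b : R} (ha : a ∈ I) (hb : b ∈ K) :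
    a * b ∈ idealMul I K := by
  rw [idealMul, TwoSidedIdeal.mem_mk']
  exact AddSubgroup.subset_closure ⟨a, ha, b, hb, rfl⟩

/-- No case for negatives is needed because `-(a * b) = (-a) * b`; the induction carries `p x` and
`p (-x)` together. -/
theorem idealMul_induction {I K : TwoSidedIdeal R} {p : R → Prop}
    (mul : ∀ a ∈ I, ∀ b ∈ K, p (a * b)) (add : ∀ x y, p x → p y → p (x + y)) {x : R}
    (hx : x ∈ idealMul I K) : p x := by
  rw [idealMul, TwoSidedIdeal.mem_mk'] at hx
  have h0 : p 0 := by simpa using mul 0 I.zero_mem 0 K.zero_mem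
  have key : p x ∧ p (-x) := by
    refine AddSubgroup.closure_induction (p := fun y _ => p y ∧ p (-y)) ?_ ?_ ?_ ?_ hx
    · rintro _ ⟨a, ha, b, hb, rfl⟩
      refine ⟨mul a ha b hb, ?_⟩
      rw [← neg_mul]
      exact mul _ (I.neg_mem ha) b hb
    · simpa using h0
    · intro u v _ _ hu hv
      refine ⟨add _ _ hu.1 hv.1, ?_⟩
      rw [neg_add]
      exact add _ _ hu.2 hv.2
    · intro u _ hu
      simpa using hu.symm
  exact key.1

theorem idealMul_le {I K L : TwoSidedIdeal R} (h : ∀ a ∈ I, ∀ b ∈ K, a * b ∈ L) :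
    idealMul I K ≤ L := fun _ hx =>
  idealMul_induction (p := (· ∈ L)) h (fun _ _ => L.add_mem) hx

theorem idealMul_le_right (I K : TwoSidedIdeal R) : idealMul I K ≤ K :=
  idealMul_le fun _ _ _ hb => K.mul_mem_left _ _ hb

theorem jSpan_le {J : TwoSidedIdeal R} {s : Set R} {I : AddSubgroup R} (hI : IsJIdeal J I)
    (hs : s ⊆ (I : Set R)) : jSpan J s ≤ I :=
  sInf_le ⟨hI, hs⟩

theorem jSpanOver_le {𝕜 : Type*} [SMul 𝕜 R] {J : TwoSidedIdeal R} {s : Set R}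
    {I : AddSubgroup R} (hI : IsJIdeal J I) (hc : ∀ c : 𝕜, ∀ x ∈ I, c • x ∈ I)
    (hs : s ⊆ (I : Set R)) : jSpanOver 𝕜 J s ≤ I :=
  sInf_le ⟨hI, hc, hs⟩

theorem jSpan_le_jSpanOver (𝕜 : Type*) [SMul 𝕜 R] (J : TwoSidedIdeal R) (s : Set R) :
    jSpan J s ≤ jSpanOver 𝕜 J s :=
  le_sInf fun _ hI => jSpan_le hI.1 hI.2.2

theorem subset_jSpan (J : TwoSidedIdeal R) (s : Set R) : s ⊆ (jSpan J s : Set R) := fun _ hx =>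
  AddSubgroup.mem_sInf.2 fun _ hI => hI.2 hx

/-- A product `a * x * b` with `a, b ∈ J` and `x ∈ s` lies in the `J`-ideal generated by `s`. -/
theorem mul_mul_mem_jSpan {J : TwoSidedIdeal R} {s : Set R} {a b x : R} (ha : a ∈ J)
    (hb : b ∈ J) (hx : x ∈ s) : a * x * b ∈ jSpan J s :=
  AddSubgroup.mem_sInf.2 fun _ hI => hI.1.mul_right _ hb _ (hI.1.mul_left _ ha _ (hI.2 hx))

end Ring

/-! ### Scalars and ideals of finite codimension -/

section Complex

variable {R : Type*} [Ring R] [Algebra ℂ R]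

theorem smul_mem_of_mem (I : TwoSidedIdeal R) (c : ℂ) {x : R} (hx : x ∈ I) : c • x ∈ I := by
  rw [← one_mul x, ← smul_mul_assoc]
  exact I.mul_mem_left _ _ hx

theorem jSpanOver_real_le_complex (J : TwoSidedIdeal R) (s : Set R) :
    jSpanOver ℝ J s ≤ jSpanOver ℂ J s :=
  le_sInf fun _ hI => jSpanOver_le hI.1 (fun c x hx => by
    have := hI.2.1 (c : ℂ) x hx
    simpa using this) hI.2.2

/-- The underlying complex subspace of a two-sided ideal of a complex algebra. -/
def idealSubmodule (I : TwoSidedIdeal R) : Submodule ℂ R where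
  carrier := I
  add_mem' := I.add_mem
  zero_mem' := I.zero_mem
  smul_mem' c _ hx := smul_mem_of_mem I c hx

@[simp] theorem mem_idealSubmodule {I : TwoSidedIdeal R} {x : R} :
    x ∈ idealSubmodule I ↔ x ∈ I := Iff.rfl

theorem isJIdeal_of_ideal {J I : TwoSidedIdeal R} (h : I ≤ J) :
    IsJIdeal J (idealSubmodule I).toAddSubgroup :=
  ⟨fun _ hx => h hx, fun _ _ _ hx => I.mul_mem_left _ _ hx, fun _ _ _ hx => I.mul_mem_right _ _ hx⟩

/-- If the ring contains two isometries with orthogonal ranges, a two-sided ideal of finite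
codimension in another one is equal to it. -/
theorem ideal_le_of_finite_codim {I Q : TwoSidedIdeal R} {v₁ w₁ v₂ w₂ : R} (h₁ : w₁ * v₁ = 1)
    (h₂ : w₂ * v₂ = 1) (h₁₂ : w₁ * v₂ = 0) {s : Set R} (hs : s.Finite)
    (h : ∀ x ∈ I, x ∈ Submodule.span ℂ s ⊔ idealSubmodule Q) : I ≤ Q := by
  set q := (idealSubmodule Q).mkQ with hq
  set V : Submodule ℂ (R ⧸ idealSubmodule Q) := (idealSubmodule I).map q with hV
  have hfin : FiniteDimensional ℂ V := by
    have h1 : V ≤ (Submodule.span ℂ s).map q := by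
      rintro _ ⟨x, hx, rfl⟩
      obtain ⟨y, hy, z, hz, rfl⟩ := Submodule.mem_sup.1 (h x hx)
      refine ⟨y, hy, ?_⟩
      rw [map_add, left_eq_add, hq, Submodule.mkQ_apply, Submodule.Quotient.mk_eq_zero]
      exact hz
    have : FiniteDimensional ℂ (Submodule.span ℂ s) := FiniteDimensional.span_of_finite ℂ hs
    exact Submodule.finiteDimensional_of_le h1
  let L : R → (R ⧸ idealSubmodule Q) →ₗ[ℂ] (R ⧸ idealSubmodule Q) := fun a =>
    (idealSubmodule Q).mapQ (idealSubmodule Q) (LinearMap.mulLeft ℂ a)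
      (fun x hx => Q.mul_mem_left _ _ hx)
  have hL : ∀ a x, L a (q x) = q (a * x) := fun a x => rfl
  have hLV : ∀ a, ∀ y ∈ V, L a y ∈ V := by
    rintro a _ ⟨x, hx, rfl⟩
    exact ⟨a * x, I.mul_mem_left _ _ hx, rfl⟩
  let M : R → V →ₗ[ℂ] V := fun a => (L a).restrict (hLV a)
  have hM : ∀ a b, M a * M b = M (a * b) := by
    intro a b
    ext ⟨_, x, hx, rfl⟩
    change L a (L b (q x)) = L (a * b) (q x)
    rw [hL, hL, hL, mul_assoc]
  have hM1 : M 1 = 1 := by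
    ext ⟨_, x, hx, rfl⟩
    change L 1 (q x) = q x
    rw [hL, one_mul]
  have hM0 : M 0 = 0 := by
    ext ⟨_, x, hx, rfl⟩
    change L 0 (q x) = 0
    rw [hL, zero_mul, map_zero]
  -- On the finite-dimensional `V` the left inverse `M w₁` is also a right inverse. Then `w₁ * v₂ =
  -- 0` forces `M v₂ = 0`, which contradicts `M w₂ * M v₂ = 1` unless `V = 0`.
  have e1 : M w₁ * M v₁ = 1 := by rw [hM, h₁, hM1]
  have e2 : M v₁ * M w₁ = 1 := mul_eq_one_comm.1 e1
  have e3 : M v₂ = 0 := by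
    rw [← one_mul (M v₂), ← e2, mul_assoc, hM, h₁₂, hM0, mul_zero]
  have e4 : (1 : V →ₗ[ℂ] V) = 0 := by rw [← hM1, ← h₂, ← hM, e3, mul_zero]
  intro x hx
  have := congrArg Subtype.val (LinearMap.congr_fun e4 ⟨q x, x, hx, rfl⟩)
  have hx0 : q x = 0 := this
  rwa [hq, Submodule.mkQ_apply, Submodule.Quotient.mk_eq_zero] at hx0

end Complex

/-! ### Factorization and self-adjointness of ideals -/

section Operators

variable {H : Type*} [NormedAddCommGroup H] [InnerProductSpace ℂ H] [CompleteSpace H]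

/-- Douglas' factorization lemma. -/
theorem exists_eq_mul_of_norm_le {A B : BH H} {c : ℝ} (h : ∀ x, ‖A x‖ ≤ c * ‖B x‖) :
    ∃ C : BH H, A = C * B := by
  set M : Submodule ℂ H := (LinearMap.range (B : H →ₗ[ℂ] H)).topologicalClosure with hM
  have hBM : ∀ x, B x ∈ M := fun x => Submodule.le_topologicalClosure _ ⟨x, rfl⟩
  let e : H →ₗ[ℂ] M := (B : H →ₗ[ℂ] H).codRestrict M hBM
  have : CompleteSpace M := (Submodule.isClosed_topologicalClosure _).completeSpace_coe
  have hd : DenseRange e := by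
    intro y
    rw [closure_subtype]
    have : (Subtype.val '' Set.range e) = Set.range B := by
      ext z; constructor
      · rintro ⟨_, ⟨x, rfl⟩, rfl⟩; exact ⟨x, rfl⟩
      · rintro ⟨x, rfl⟩; exact ⟨e x, ⟨x, rfl⟩, rfl⟩
    rw [this]
    exact y.2
  -- `C` extends `B x ↦ A x` continuously to the closure of the range of `B` and vanishes on its
  -- orthogonal complement.
  refine ⟨((A : H →ₗ[ℂ] H).extendOfNorm e) ∘L M.orthogonalProjectionOnto, ?_⟩
  ext x
  have h1 : M.orthogonalProjectionOnto (B x) = e x :=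
    Submodule.orthogonalProjectionOnto_mem_subspace_eq_self (e x)
  change A x = ((A : H →ₗ[ℂ] H).extendOfNorm e) (M.orthogonalProjectionOnto (B x))
  rw [h1, LinearMap.extendOfNorm_eq hd ⟨c, fun x => h x⟩]
  rfl

theorem mem_of_norm_le {I : TwoSidedIdeal (BH H)} {A B : BH H} (hB : B ∈ I) {c : ℝ}
    (h : ∀ x, ‖A x‖ ≤ c * ‖B x‖) : A ∈ I := by
  obtain ⟨C, rfl⟩ := exists_eq_mul_of_norm_le h
  exact I.mul_mem_left _ _ hB

theorem norm_apply_eq_of_star_mul_eq {A B : BH H} (h : star A * A = star B * B) (x : H) :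
    ‖A x‖ = ‖B x‖ := by
  have key : ∀ C : BH H, ‖C x‖ ^ 2 = RCLike.re (inner ℂ ((star C * C) x) x) := by
    intro C
    rw [mul_apply_eq_comp, ContinuousLinearMap.star_eq_adjoint,
      ContinuousLinearMap.adjoint_inner_left, inner_self_eq_norm_sq]
  have := key A
  rw [h, ← key B] at this
  exact (sq_eq_sq₀ (norm_nonneg _) (norm_nonneg _)).1 this

theorem star_abs (T : BH H) : star (CFC.abs T) = CFC.abs T :=
  (IsSelfAdjoint.of_nonneg (CFC.abs_nonneg T)).star_eq

theorem norm_abs_apply (T : BH H) (x : H) : ‖CFC.abs T x‖ = ‖T x‖ :=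
  norm_apply_eq_of_star_mul_eq (by rw [star_abs, CFC.abs_mul_abs]) x

theorem abs_mem_iff {I : TwoSidedIdeal (BH H)} {T : BH H} : CFC.abs T ∈ I ↔ T ∈ I :=
  ⟨fun h => mem_of_norm_le h (c := 1) fun x => by rw [norm_abs_apply, one_mul],
    fun h => mem_of_norm_le h (c := 1) fun x => by rw [norm_abs_apply, one_mul]⟩

/-- From `T = W |T|` one gets `T* = |T| W*`, and `|T|` lies in the same ideals as `T`. -/
theorem star_mem_ideal {I : TwoSidedIdeal (BH H)} {T : BH H} (hT : T ∈ I) : star T ∈ I := by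
  obtain ⟨W, hW⟩ := exists_eq_mul_of_norm_le (A := T) (B := CFC.abs T) (c := 1)
    fun x => by rw [norm_abs_apply, one_mul]
  rw [hW, star_mul, star_abs]
  exact I.mul_mem_right _ _ (abs_mem_iff.2 hT)

theorem idealMul_comm (I K : TwoSidedIdeal (BH H)) : idealMul I K = idealMul K I := by
  have key : ∀ I K : TwoSidedIdeal (BH H), idealMul I K ≤ idealMul K I := by
    intro I K
    refine idealMul_le fun a ha b hb => ?_
    have := star_mem_ideal (mul_mem_idealMul (star_mem_ideal hb) (star_mem_ideal ha))
    simpa using this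
  exact le_antisymm (key _ _) (key _ _)

/-- Douglas' lemma applied to the square roots gives `√A = C √B`, hence `A = C B C*`. -/
theorem mem_of_nonneg_of_le {I : TwoSidedIdeal (BH H)} {A B : BH H} (hB : B ∈ I) (hA : 0 ≤ A)
    (hAB : A ≤ B) : A ∈ I := by
  have key : ∀ C : BH H, 0 ≤ C → ∀ x, ‖CFC.sqrt C x‖ ^ 2 = RCLike.re (inner ℂ (C x) x) := by
    intro C hC x
    have hs : star (CFC.sqrt C) = CFC.sqrt C :=
      (IsSelfAdjoint.of_nonneg (CFC.sqrt_nonneg C)).star_eq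
    conv_rhs => rw [← CFC.sqrt_mul_sqrt_self C hC]
    nth_rewrite 2 [← hs]
    rw [mul_apply_eq_comp, ContinuousLinearMap.star_eq_adjoint,
      ContinuousLinearMap.adjoint_inner_left, inner_self_eq_norm_sq]
  obtain ⟨C, hC⟩ := exists_eq_mul_of_norm_le (A := CFC.sqrt A) (B := CFC.sqrt B) (c := 1) (by
    intro x
    rw [one_mul, ← sq_le_sq₀ (norm_nonneg _) (norm_nonneg _), key A hA, key B (hA.trans hAB)]
    have := ((ContinuousLinearMap.le_def A B).1 hAB).re_inner_nonneg_left x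
    rw [sub_apply, inner_sub_left, map_sub] at this
    linarith)
  have hs : ∀ D : BH H, star (CFC.sqrt D) = CFC.sqrt D := fun D =>
    (IsSelfAdjoint.of_nonneg (CFC.sqrt_nonneg D)).star_eq
  have : A = C * B * star C := by
    rw [← CFC.sqrt_mul_sqrt_self A hA]
    nth_rewrite 2 [← hs]
    rw [hC, star_mul, hs, ← mul_assoc, mul_assoc C, CFC.sqrt_mul_sqrt_self B (hA.trans hAB)]
  rw [this]
  exact I.mul_mem_right _ _ (I.mul_mem_left _ _ hB)

theorem span_range_eq_span_sum_abs {N : ℕ} (S : Fin N → BH H) :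
    TwoSidedIdeal.span (Set.range S) = TwoSidedIdeal.span {∑ k, CFC.abs (S k)} := by
  apply le_antisymm
  · rw [TwoSidedIdeal.span_le]
    rintro _ ⟨j, rfl⟩
    refine abs_mem_iff.1 (mem_of_nonneg_of_le (TwoSidedIdeal.subset_span rfl)
      (CFC.abs_nonneg _) ?_)
    exact Finset.single_le_sum (f := fun k => CFC.abs (S k)) (fun k _ => CFC.abs_nonneg _)
      (Finset.mem_univ j)
  · rw [TwoSidedIdeal.span_le, Set.singleton_subset_iff]
    exact sum_mem fun k _ => abs_mem_iff.2 (TwoSidedIdeal.subset_span ⟨k, rfl⟩)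

end Operators

end Subideal

namespace Subideal

/-! ### Hilbert bases and operators with orthogonal images -/

section Basis

variable {H : Type*} [NormedAddCommGroup H] [InnerProductSpace ℂ H]

/-- Distinct orthonormal vectors are at distance `√2`, so balls of radius `1/2` around them are
disjoint. -/
theorem countable_of_orthonormal [TopologicalSpace.SeparableSpace H] {w : Set H}
    (hw : Orthonormal ℂ ((↑) : w → H)) : Countable w := by
  refine Pairwise.countable_of_isOpen_disjoint (s := fun x : w => Metric.ball (x : H) (1 / 2))
    ?_ (fun _ => Metric.isOpen_ball) (fun x => Metric.nonempty_ball.2 (by norm_num))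
  intro x y hxy
  refine Metric.ball_disjoint_ball ?_
  have h1 : ‖(x : H) - y‖ * ‖(x : H) - y‖ = 2 := by
    rw [sub_eq_add_neg, norm_add_sq_eq_norm_sq_add_norm_sq_of_inner_eq_zero (𝕜 := ℂ), norm_neg,
      hw.1 x, hw.1 y]
    · norm_num
    · rw [inner_neg_right, hw.2 hxy, neg_zero]
  rw [dist_eq_norm]
  nlinarith [norm_nonneg ((x : H) - y)]

theorem exists_nat_hilbertBasis [CompleteSpace H] [TopologicalSpace.SeparableSpace H]
    (hH : ¬ FiniteDimensional ℂ H) : Nonempty (HilbertBasis ℕ ℂ H) := by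
  obtain ⟨w, b, hb⟩ := exists_hilbertBasis ℂ H
  have ho : Orthonormal ℂ ((↑) : w → H) := hb ▸ b.orthonormal
  have hc : Countable w := countable_of_orthonormal ho
  have hi : Infinite w := by
    by_contra hfin
    rw [not_infinite_iff_finite] at hfin
    have : Fintype w := Fintype.ofFinite w
    exact hH b.toOrthonormalBasis.toBasis.finiteDimensional_of_finite
  obtain ⟨e⟩ := nonempty_denumerable_iff.2 ⟨hc, hi⟩
  have f : ℕ ≃ w := (Denumerable.eqv w).symm
  refine ⟨HilbertBasis.mk (v := b ∘ f) (b.orthonormal.comp f f.injective) ?_⟩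
  rw [Set.range_comp, f.range_eq_univ, Set.image_univ, b.dense_span]

/-- A family of pairwise orthogonal vectors satisfies the theorem of Pythagoras. -/
theorem norm_sum_smul_sq {y : ℕ → H} (hy : Pairwise fun i j => inner ℂ (y i) (y j) = 0)
    (c : ℕ → ℂ) (s : Finset ℕ) :
    ‖∑ i ∈ s, c i • y i‖ ^ 2 = ∑ i ∈ s, ‖c i‖ ^ 2 * ‖y i‖ ^ 2 := by
  induction s using Finset.induction_on with
  | empty => simp
  | insert a s ha ih =>
    rw [Finset.sum_insert ha, Finset.sum_insert ha, ← ih, sq,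
      norm_add_sq_eq_norm_sq_add_norm_sq_of_inner_eq_zero (𝕜 := ℂ), norm_smul]
    · ring
    · rw [inner_smul_left, inner_sum, Finset.sum_eq_zero, mul_zero]
      intro i hi
      rw [inner_smul_right, hy (by rintro rfl; exact ha hi), mul_zero]

variable (b : HilbertBasis ℕ ℂ H)

theorem hasSum_norm_sq {L : BH H} (hL : Pairwise fun i j => inner ℂ (L (b i)) (L (b j)) = 0)
    (x : H) : HasSum (fun n => ‖b.repr x n‖ ^ 2 * ‖L (b n)‖ ^ 2) (‖L x‖ ^ 2) := by
  have h1 : HasSum (fun n => b.repr x n • L (b n)) (L x) := by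
    simpa using (b.hasSum_repr x).mapL L
  have h2 : Tendsto (fun s : Finset ℕ => ‖∑ n ∈ s, b.repr x n • L (b n)‖ ^ 2) atTop
      (nhds (‖L x‖ ^ 2)) := (Tendsto.norm h1).pow 2
  simp_rw [norm_sum_smul_sq hL] at h2
  exact h2

/-- By Parseval, when both operators map the basis to orthogonal families, domination need only be
checked on basis vectors. With Douglas' lemma this becomes a test for ideal membership. -/
theorem norm_apply_le_of_basis {L L' : BH H}
    (hL : Pairwise fun i j => inner ℂ (L (b i)) (L (b j)) = 0)
    (hL' : Pairwise fun i j => inner ℂ (L' (b i)) (L' (b j)) = 0) {c : ℝ} (hc : 0 ≤ c)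
    (h : ∀ n, ‖L (b n)‖ ≤ c * ‖L' (b n)‖) (x : H) : ‖L x‖ ≤ c * ‖L' x‖ := by
  rw [← sq_le_sq₀ (norm_nonneg _) (by positivity), mul_pow]
  refine hasSum_le (fun n => ?_) (hasSum_norm_sq b hL x) ((hasSum_norm_sq b hL' x).mul_left (c ^ 2))
  calc ‖b.repr x n‖ ^ 2 * ‖L (b n)‖ ^ 2 ≤ ‖b.repr x n‖ ^ 2 * (c * ‖L' (b n)‖) ^ 2 := by
        gcongr; exact h n
    _ = c ^ 2 * (‖b.repr x n‖ ^ 2 * ‖L' (b n)‖ ^ 2) := by ring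

theorem mem_of_norm_basis_le [CompleteSpace H] {I : TwoSidedIdeal (BH H)} {L L' : BH H}
    (hI : L' ∈ I)
    (hL : Pairwise fun i j => inner ℂ (L (b i)) (L (b j)) = 0)
    (hL' : Pairwise fun i j => inner ℂ (L' (b i)) (L' (b j)) = 0) {c : ℝ} (hc : 0 ≤ c)
    (h : ∀ n, ‖L (b n)‖ ≤ c * ‖L' (b n)‖) : L ∈ I :=
  mem_of_norm_le hI (norm_apply_le_of_basis b hL hL' hc h)

theorem ext_basis {L L' : BH H} (h : ∀ n, L (b n) = L' (b n)) : L = L' := by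
  ext x
  have h1 := (b.hasSum_repr x).mapL L
  have h2 := (b.hasSum_repr x).mapL L'
  simp only [map_smul, h] at h1 h2
  exact h1.unique h2

/-- A bounded family of pairwise orthogonal vectors is the image of a Hilbert basis under a
bounded operator. -/
theorem exists_operator_of_orthogonal [CompleteSpace H] {y : ℕ → H}
    (hy : Pairwise fun i j => inner ℂ (y i) (y j) = 0) {C : ℝ} (hC : ∀ n, ‖y n‖ ≤ C) :
    ∃ L : BH H, ∀ n, L (b n) = y n := by
  let e : (ℕ →₀ ℂ) →ₗ[ℂ] H := Finsupp.linearCombination ℂ b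
  let f : (ℕ →₀ ℂ) →ₗ[ℂ] H := Finsupp.linearCombination ℂ y
  have hd : DenseRange e := by
    have h1 : Set.range e = (Submodule.span ℂ (Set.range b) : Set H) := by
      rw [← Finsupp.range_linearCombination]; rfl
    rw [DenseRange, h1, Submodule.dense_iff_topologicalClosure_eq_top, b.dense_span]
  have hC0 : 0 ≤ C := (norm_nonneg _).trans (hC 0)
  have hn : ∀ x, ‖f x‖ ≤ C * ‖e x‖ := by
    intro x
    rw [← sq_le_sq₀ (norm_nonneg _) (by positivity), mul_pow]
    have h1 : e x = ∑ i ∈ x.support, x i • b i := Finsupp.linearCombination_apply ℂ x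
    have h2 : f x = ∑ i ∈ x.support, x i • y i := Finsupp.linearCombination_apply ℂ x
    rw [h1, h2, norm_sum_smul_sq hy, norm_sum_smul_sq (fun i j h => b.orthonormal.2 h),
      Finset.mul_sum]
    refine Finset.sum_le_sum fun i _ => ?_
    rw [b.orthonormal.1 i]
    calc ‖x i‖ ^ 2 * ‖y i‖ ^ 2 ≤ ‖x i‖ ^ 2 * C ^ 2 := by gcongr; exact hC i
      _ = _ := by ring
  refine ⟨f.extendOfNorm e, fun n => ?_⟩
  have := LinearMap.extendOfNorm_eq hd ⟨C, hn⟩ (Finsupp.single n 1)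
  simpa [e, f] using this

theorem exists_isometry_of_orthonormal [CompleteSpace H] {e : ℕ → H} (he : Orthonormal ℂ e) :
    ∃ V : BH H, (∀ n, V (b n) = e n) ∧ star V * V = 1 := by
  obtain ⟨V, hV⟩ := exists_operator_of_orthogonal b (fun i j h => he.2 h) (C := 1)
    (fun n => (he.1 n).le)
  refine ⟨V, hV, ?_⟩
  have h1 : ∀ x, ‖V x‖ = ‖x‖ := by
    intro x
    have := hasSum_norm_sq b (L := V) (fun i j h => by simp only [hV, he.2 h]) x
    have h2 := hasSum_norm_sq b (L := 1) (fun i j h => b.orthonormal.2 h) x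
    simp only [hV, he.1, one_apply_eq_self, b.orthonormal.1] at this h2
    exact (sq_eq_sq₀ (norm_nonneg _) (norm_nonneg _)).1 (this.unique h2)
  exact (ContinuousLinearMap.norm_map_iff_adjoint_comp_self V).1 h1

end Basis

/-! ### Inequalities for s-numbers -/

section SNumbers

variable {H : Type*} [NormedAddCommGroup H] [InnerProductSpace ℂ H]

theorem sNum_bddBelow (T : BH H) (n : ℕ) : BddBelow (Set.range
    fun F : {F : BH H // LinearMap.rank (F : H →ₗ[ℂ] H) ≤ (n : Cardinal)} => ‖T - F.1‖) :=
  ⟨0, by rintro _ ⟨F, rfl⟩; exact norm_nonneg _⟩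

instance (n : ℕ) : Nonempty {F : BH H // LinearMap.rank (F : H →ₗ[ℂ] H) ≤ (n : Cardinal)} :=
  ⟨⟨0, by simp [LinearMap.rank_zero]⟩⟩

theorem sNum_nonneg (T : BH H) (n : ℕ) : 0 ≤ sNum T n := Real.iInf_nonneg fun _ => norm_nonneg _

theorem sNum_le {T F : BH H} {n : ℕ} (hF : LinearMap.rank (F : H →ₗ[ℂ] H) ≤ (n : Cardinal)) :
    sNum T n ≤ ‖T - F‖ :=
  ciInf_le (sNum_bddBelow T n) (⟨F, hF⟩ : {F : BH H // LinearMap.rank (F : H →ₗ[ℂ] H) ≤ n})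

theorem exists_norm_sub_lt (T : BH H) (n : ℕ) {ε : ℝ} (hε : 0 < ε) :
    ∃ F : BH H, LinearMap.rank (F : H →ₗ[ℂ] H) ≤ (n : Cardinal) ∧ ‖T - F‖ < sNum T n + ε := by
  obtain ⟨F, hF⟩ := exists_lt_of_ciInf_lt (lt_add_of_pos_right (sNum T n) hε)
  exact ⟨F.1, F.2, hF⟩

theorem le_sNum {T : BH H} {n : ℕ} {c : ℝ}
    (h : ∀ F : BH H, LinearMap.rank (F : H →ₗ[ℂ] H) ≤ (n : Cardinal) → c ≤ ‖T - F‖) :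
    c ≤ sNum T n :=
  le_ciInf fun F => h F.1 F.2

theorem sNum_antitone (T : BH H) : Antitone (sNum T) := fun n m h =>
  le_sNum fun _ hF => sNum_le (hF.trans (by exact_mod_cast h))

theorem sNum_zero (T : BH H) : sNum T 0 = ‖T‖ := by
  refine le_antisymm ?_ (le_sNum fun F hF => ?_)
  · simpa using sNum_le (T := T) (F := 0) (n := 0) (by simp [LinearMap.rank_zero])
  · have h0 : LinearMap.range (F : H →ₗ[ℂ] H) = ⊥ :=
      Submodule.rank_eq_zero.1 (le_antisymm (by simpa using hF) bot_le)
    have : F = 0 := by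
      ext x
      exact LinearMap.congr_fun (LinearMap.range_eq_bot.1 h0) x
    rw [this, sub_zero]

theorem sNum_le_norm (T : BH H) (n : ℕ) : sNum T n ≤ ‖T‖ :=
  sNum_zero T ▸ sNum_antitone T n.zero_le

theorem sNum_add_le (A B : BH H) (n m : ℕ) : sNum (A + B) (n + m) ≤ sNum A n + sNum B m := by
  refine le_of_forall_pos_le_add fun ε hε => ?_
  obtain ⟨F, hF, hF'⟩ := exists_norm_sub_lt A n (half_pos hε)
  obtain ⟨G, hG, hG'⟩ := exists_norm_sub_lt B m (half_pos hε)
  have h1 : sNum (A + B) (n + m) ≤ ‖A + B - (F + G)‖ := sNum_le (by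
    push_cast
    exact (LinearMap.rank_add_le _ _).trans (add_le_add hF hG))
  have h2 : ‖A + B - (F + G)‖ ≤ ‖A - F‖ + ‖B - G‖ := by
    rw [add_sub_add_comm]; exact norm_add_le _ _
  linarith

theorem sNum_mul_le (A B : BH H) (n m : ℕ) : sNum (A * B) (n + m) ≤ sNum A n * sNum B m := by
  have key : ∀ F : BH H, LinearMap.rank (F : H →ₗ[ℂ] H) ≤ (n : Cardinal) →
      ∀ G : BH H, LinearMap.rank (G : H →ₗ[ℂ] H) ≤ (m : Cardinal) →
      sNum (A * B) (n + m) ≤ ‖A - F‖ * ‖B - G‖ := by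
    intro F hF G hG
    have h1 : sNum (A * B) (n + m) ≤ ‖A * B - (F * (B - G) + A * G)‖ := sNum_le (by
      push_cast
      refine (LinearMap.rank_add_le _ _).trans (add_le_add ?_ ?_)
      · exact (LinearMap.rank_comp_le_left ((B - G : BH H) : H →ₗ[ℂ] H) (F : H →ₗ[ℂ] H)).trans hF
      · exact (LinearMap.rank_comp_le_right (G : H →ₗ[ℂ] H) (A : H →ₗ[ℂ] H)).trans hG)
    -- The approximant has rank at most `n + m`, and the error factors exactly.
    have h2 : A * B - (F * (B - G) + A * G) = (A - F) * (B - G) := by noncomm_ring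
    rw [h2] at h1
    exact h1.trans (norm_mul_le _ _)
  have h1 : ∀ G : BH H, LinearMap.rank (G : H →ₗ[ℂ] H) ≤ (m : Cardinal) →
      sNum (A * B) (n + m) ≤ sNum A n * ‖B - G‖ := by
    intro G hG
    conv_rhs => rw [sNum, Real.iInf_mul_of_nonneg (norm_nonneg _)]
    exact le_ciInf fun F => key F.1 F.2 G hG
  conv_rhs => rw [sNum.eq_def B, Real.mul_iInf_of_nonneg (sNum_nonneg _ _)]
  exact le_ciInf fun G => h1 G.1 G.2

/-- An operator of rank at most `n` kills a nonzero vector of the `(n + 1)`-dimensional `W`. -/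
theorem le_sNum_of_subspace {T : BH H} {n : ℕ} {c : ℝ} (W : Submodule ℂ H)
    (hW : Module.finrank ℂ W = n + 1) (h : ∀ x ∈ W, c * ‖x‖ ≤ ‖T x‖) : c ≤ sNum T n := by
  refine le_sNum fun F hF => ?_
  have : FiniteDimensional ℂ W := FiniteDimensional.of_finrank_pos (by omega)
  have hFfin : FiniteDimensional ℂ (LinearMap.range (F : H →ₗ[ℂ] H)) :=
    Module.rank_lt_aleph0_iff.1 (lt_of_le_of_lt hF (Cardinal.natCast_lt_aleph0))
  have hr : Module.finrank ℂ (LinearMap.range (F : H →ₗ[ℂ] H)) ≤ n := by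
    have := hF
    rw [LinearMap.rank, ← Module.finrank_eq_rank] at this
    exact_mod_cast this
  have hk := LinearMap.ker_ne_bot_of_finrank_lt
    (f := (F : H →ₗ[ℂ] H).rangeRestrict.domRestrict W) (by omega)
  obtain ⟨x, hx, hx0⟩ := Submodule.exists_mem_ne_zero_of_ne_bot hk
  have hFx : F x = 0 := congrArg Subtype.val (LinearMap.mem_ker.1 hx)
  have hxn : 0 < ‖(x : H)‖ := norm_pos_iff.2 (fun h => hx0 (Subtype.ext h))
  refine le_of_mul_le_mul_right ?_ hxn
  calc c * ‖(x : H)‖ ≤ ‖T x‖ := h x x.2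
    _ = ‖(T - F) x‖ := by rw [sub_apply, hFx, sub_zero]
    _ ≤ ‖T - F‖ * ‖(x : H)‖ := (T - F).le_opNorm _

theorem le_sNum_of_orthogonal {T : BH H} {e : ℕ → H} (he : Orthonormal ℂ e)
    (hT : Pairwise fun i j => inner ℂ (T (e i)) (T (e j)) = 0) {n : ℕ} {c : ℝ} (hc : 0 ≤ c)
    (h : ∀ i ≤ n, c ≤ ‖T (e i)‖) : c ≤ sNum T n := by
  classical
  refine le_sNum_of_subspace (Submodule.span ℂ (Set.range fun i : Fin (n + 1) => e i)) ?_ ?_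
  · have := finrank_span_eq_card (he.linearIndependent.comp _ (Fin.val_injective (n := n + 1)))
    rwa [Fintype.card_fin] at this
  · intro x hx
    obtain ⟨a, rfl⟩ := (Submodule.mem_span_range_iff_exists_fun ℂ).1 hx
    set a' : ℕ → ℂ := fun i => if hi : i < n + 1 then a ⟨i, hi⟩ else 0 with ha'
    have e1 : ∑ i : Fin (n + 1), a i • e i = ∑ i ∈ Finset.range (n + 1), a' i • e i := by
      rw [← Fin.sum_univ_eq_sum_range (fun i => a' i • e i)]
      exact Finset.sum_congr rfl fun i _ => by simp only [ha', i.2, dif_pos]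
    rw [e1, ← sq_le_sq₀ (by positivity) (norm_nonneg _), mul_pow, map_sum]
    simp_rw [map_smul]
    rw [norm_sum_smul_sq hT, norm_sum_smul_sq (fun i j h => he.2 h), Finset.mul_sum]
    refine Finset.sum_le_sum fun i hi => ?_
    rw [he.1 i]
    have := h i (by simpa [Nat.lt_succ_iff] using hi)
    calc c ^ 2 * (‖a' i‖ ^ 2 * 1 ^ 2) = ‖a' i‖ ^ 2 * c ^ 2 := by ring
      _ ≤ _ := by gcongr

end SNumbers

end Subideal

namespace Subideal

/-- A sequence defined by strong recursion, choosing at each step an element related to the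
previous ones. -/
noncomputable def recSeq {α : Type*} {Q : (n : ℕ) → (Fin n → α) → α → Prop}
    (h : ∀ n g, ∃ y, Q n g y) (n : ℕ) : α :=
  (h n fun i : Fin n => recSeq h i).choose
termination_by n
decreasing_by exact i.2

theorem exists_seq_of_forall_fin {α : Type*} {Q : (n : ℕ) → (Fin n → α) → α → Prop}
    (h : ∀ n g, ∃ y, Q n g y) : ∃ f : ℕ → α, ∀ n, Q n (fun i => f i) (f n) := by
  refine ⟨recSeq h, fun n => ?_⟩
  rw [recSeq]
  exact (h n fun i : Fin n => recSeq h i).choose_spec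

/-! ### Diagonal operators in an ideal -/

section Diagonal

variable {H : Type*} [NormedAddCommGroup H] [InnerProductSpace ℂ H]

/-- The ideal `I` contains the diagonal operator with entries `ξ` in the basis `b`. -/
def DiagMem (b : HilbertBasis ℕ ℂ H) (I : TwoSidedIdeal (BH H)) (ξ : ℕ → ℝ) : Prop :=
  ∃ D ∈ I, ∀ n, D (b n) = (ξ n : ℂ) • b n

variable {b : HilbertBasis ℕ ℂ H}

theorem diag_orthogonal {D : BH H} {ξ : ℕ → ℝ} (hD : ∀ n, D (b n) = (ξ n : ℂ) • b n) :
    Pairwise fun i j => inner ℂ (D (b i)) (D (b j)) = 0 := fun i j h => by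
  simp only [hD, inner_smul_left, inner_smul_right, b.orthonormal.2 h, mul_zero]

theorem diag_norm {D : BH H} {ξ : ℕ → ℝ} (hD : ∀ n, D (b n) = (ξ n : ℂ) • b n) (n : ℕ) :
    ‖D (b n)‖ = |ξ n| := by
  rw [hD, norm_smul, b.orthonormal.1, mul_one, Complex.norm_real, Real.norm_eq_abs]

theorem DiagMem.zero (I : TwoSidedIdeal (BH H)) : DiagMem b I 0 :=
  ⟨0, I.zero_mem, fun n => by simp⟩

theorem DiagMem.add {I : TwoSidedIdeal (BH H)} {ξ η : ℕ → ℝ} (hξ : DiagMem b I ξ)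
    (hη : DiagMem b I η) : DiagMem b I (ξ + η) := by
  obtain ⟨D, hDI, hD⟩ := hξ
  obtain ⟨E, hEI, hE⟩ := hη
  refine ⟨D + E, I.add_mem hDI hEI, fun n => ?_⟩
  rw [add_apply, hD, hE, ← add_smul, Pi.add_apply, Complex.ofReal_add]

theorem DiagMem.sum {I : TwoSidedIdeal (BH H)} {ι : Type*} {s : Finset ι} {ξ : ι → ℕ → ℝ}
    (h : ∀ i ∈ s, DiagMem b I (ξ i)) : DiagMem b I (∑ i ∈ s, ξ i) :=
  Finset.sum_induction _ (DiagMem b I) (fun _ _ => .add) (.zero I) h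

theorem DiagMem.mul {I K : TwoSidedIdeal (BH H)} {ξ η : ℕ → ℝ} (hξ : DiagMem b I ξ)
    (hη : DiagMem b K η) : DiagMem b (idealMul I K) (ξ * η) := by
  obtain ⟨D, hDI, hD⟩ := hξ
  obtain ⟨E, hEI, hE⟩ := hη
  refine ⟨D * E, mul_mem_idealMul hDI hEI, fun n => ?_⟩
  rw [mul_apply_eq_comp, hE, map_smul, hD, smul_smul, Pi.mul_apply, Complex.ofReal_mul, mul_comm]

theorem DiagMem.exists_le_sNum {I : TwoSidedIdeal (BH H)} {ξ : ℕ → ℝ} (h : DiagMem b I ξ)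
    (hξ : Antitone ξ) (h0 : ∀ n, 0 ≤ ξ n) : ∃ T ∈ I, ∀ n, ξ n ≤ sNum T n := by
  obtain ⟨D, hDI, hD⟩ := h
  refine ⟨D, hDI, fun n => le_sNum_of_orthogonal b.orthonormal (diag_orthogonal hD) (h0 n) ?_⟩
  intro i hi
  rw [diag_norm hD, abs_of_nonneg (h0 i)]
  exact hξ hi

/-- Otherwise `T` has norm at most `sNum T n / 2` on `Mᗮ`, and subtracting `T P_M`, of rank at most
`n`, approximates `T` too well. The factor 2 replaces attainment of the norm, which may fail for
noncompact `T`. -/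
theorem exists_unit_orthogonal (hH : ¬ FiniteDimensional ℂ H) (T : BH H) {n : ℕ}
    (M : Submodule ℂ H) [FiniteDimensional ℂ M] (hM : Module.finrank ℂ M ≤ n) :
    ∃ y ∈ Mᗮ, ‖y‖ = 1 ∧ sNum T n ≤ 2 * ‖T y‖ := by
  by_contra! hcon
  have hne : Mᗮ ≠ ⊥ := by
    intro h
    rw [Submodule.orthogonal_eq_bot_iff] at h
    subst h
    exact hH (LinearEquiv.finiteDimensional (Submodule.topEquiv (R := ℂ) (M := H)))
  obtain ⟨z, hz, hz0⟩ := Submodule.exists_mem_ne_zero_of_ne_bot hne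
  have hbound : ∀ y ∈ Mᗮ, ‖T y‖ ≤ sNum T n / 2 * ‖y‖ := by
    intro y hy
    rcases eq_or_ne y 0 with rfl | hy0
    · simp
    have := hcon (((‖y‖⁻¹ : ℝ) : ℂ) • y) (Submodule.smul_mem _ _ hy) (by
      rw [norm_smul, Complex.norm_real, norm_inv, norm_norm,
        inv_mul_cancel₀ (norm_ne_zero_iff.2 hy0)])
    rw [map_smul, norm_smul, Complex.norm_real, norm_inv, norm_norm] at this
    have hyp : 0 < ‖y‖ := norm_pos_iff.2 hy0
    have h2 : ‖y‖⁻¹ * ‖T y‖ ≤ sNum T n / 2 := by linarith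
    rw [inv_mul_le_iff₀ hyp] at h2
    linarith
  have hpos : 0 < sNum T n := by
    have := hcon (((‖z‖⁻¹ : ℝ) : ℂ) • z) (Submodule.smul_mem _ _ hz) (by
      rw [norm_smul, Complex.norm_real, norm_inv, norm_norm,
        inv_mul_cancel₀ (norm_ne_zero_iff.2 hz0)])
    exact lt_of_le_of_lt (by positivity) this
  have h1 : sNum T n ≤ ‖T - T * M.starProjection‖ := by
    refine sNum_le ?_
    refine (LinearMap.rank_comp_le_right (M.starProjection : H →ₗ[ℂ] H) (T : H →ₗ[ℂ] H)).trans ?_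
    have h2 : LinearMap.range (M.starProjection : H →ₗ[ℂ] H) = M := M.range_starProjection
    rw [LinearMap.rank, h2, ← Module.finrank_eq_rank]
    exact_mod_cast hM
  have h2 : ‖T - T * M.starProjection‖ ≤ sNum T n / 2 := by
    refine ContinuousLinearMap.opNorm_le_bound _ (by linarith) fun x => ?_
    have hx : x - M.starProjection x ∈ Mᗮ := M.sub_starProjection_mem_orthogonal x
    have h3 : (T - T * M.starProjection) x = T (x - M.starProjection x) := by
      rw [sub_apply, mul_apply_eq_comp, map_sub]
    rw [h3]
    refine (hbound _ hx).trans (mul_le_mul_of_nonneg_left ?_ (by linarith))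
    have h4 : x - M.starProjection x = Mᗮ.starProjection x := by
      rw [Submodule.starProjection_orthogonal', sub_apply]; rfl
    rw [h4]
    exact Mᗮ.norm_starProjection_apply_le x
  linarith

theorem exists_unit_mem_orthogonal (hH : ¬ FiniteDimensional ℂ H) (M : Submodule ℂ H)
    [FiniteDimensional ℂ M] : ∃ y ∈ Mᗮ, ‖y‖ = 1 := by
  obtain ⟨y, hy, hy1, -⟩ := exists_unit_orthogonal hH 0 M le_rfl
  exact ⟨y, hy, hy1⟩

end Diagonal

/-! ### From an operator to the diagonal of its s-numbers -/

section Operators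

variable {H : Type*} [NormedAddCommGroup H] [InnerProductSpace ℂ H] [CompleteSpace H]

/-- These isometries split the basis into residue classes mod `m`. They build ampliations as `∑ W r
* D * star (W r)`, and for `m = 2` supply the pair used in the finite-codimension argument. -/
theorem exists_shifts (b : HilbertBasis ℕ ℂ H) (m : ℕ) (hm : 0 < m) : ∃ W : ℕ → BH H,
    (∀ r q, W r (b q) = b (m * q + r)) ∧ (∀ r, star (W r) * W r = 1) ∧
      ∀ r < m, ∀ s < m, r ≠ s → star (W r) * W s = 0 := by
  have h1 : ∀ r, ∃ V : BH H, (∀ q, V (b q) = b (m * q + r)) ∧ star V * V = 1 := fun r =>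
    exists_isometry_of_orthonormal b (b.orthonormal.comp (fun q => m * q + r) (fun p q h => by
      simpa [hm.ne'] using h))
  choose W hW hW1 using h1
  refine ⟨W, hW, hW1, fun r hr s hs hrs => ext_basis b fun q => ?_⟩
  have h0 : b.repr ((star (W r) * W s) (b q)) = 0 := by
    ext p
    rw [b.repr_apply_apply, mul_apply_eq_comp, ContinuousLinearMap.star_eq_adjoint,
      ContinuousLinearMap.adjoint_inner_right, hW, hW, b.orthonormal.2]
    · rfl
    · intro h
      have h2 := congrArg (· % m) h
      simp only [Nat.mul_add_mod, Nat.mod_eq_of_lt hr, Nat.mod_eq_of_lt hs] at h2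
      exact hrs h2
  simpa using h0

variable {b : HilbertBasis ℕ ℂ H}

theorem DiagMem.of_apply {I : TwoSidedIdeal (BH H)} {ξ : ℕ → ℝ} {L : BH H} (hLI : L ∈ I)
    (hL : Pairwise fun i j => inner ℂ (L (b i)) (L (b j)) = 0) {c : ℝ} (hc : 0 ≤ c)
    (h : ∀ n, |ξ n| ≤ c * ‖L (b n)‖) : DiagMem b I ξ := by
  obtain ⟨D, hD⟩ := exists_operator_of_orthogonal b (y := fun n => (ξ n : ℂ) • b n)
    (fun i j h => by simp only [inner_smul_left, inner_smul_right, b.orthonormal.2 h, mul_zero])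
    (C := c * ‖L‖) (fun n => by
      rw [norm_smul, b.orthonormal.1, mul_one, Complex.norm_real, Real.norm_eq_abs]
      refine (h n).trans (mul_le_mul_of_nonneg_left ?_ hc)
      simpa [b.orthonormal.1] using L.le_opNorm (b n))
  exact ⟨D, mem_of_norm_basis_le b hLI (diag_orthogonal hD) hL hc
    (fun n => by rw [diag_norm hD]; exact h n), hD⟩

theorem DiagMem.mono {I : TwoSidedIdeal (BH H)} {ξ η : ℕ → ℝ} (h : DiagMem b I η) {c : ℝ}
    (hc : 0 ≤ c) (hξ : ∀ n, |ξ n| ≤ c * |η n|) : DiagMem b I ξ := by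
  obtain ⟨D, hDI, hD⟩ := h
  exact .of_apply hDI (diag_orthogonal hD) hc fun n => by rw [diag_norm hD]; exact hξ n

theorem DiagMem.ampliation {I : TwoSidedIdeal (BH H)} {ξ : ℕ → ℝ} (h : DiagMem b I ξ) {m : ℕ}
    (hm : 0 < m) : DiagMem b I (ampliation m ξ) := by
  obtain ⟨D, hDI, hD⟩ := h
  obtain ⟨W, hW, hW1, hW0⟩ := exists_shifts b m hm
  refine ⟨∑ r ∈ Finset.range m, W r * D * star (W r),
    sum_mem fun r _ => I.mul_mem_right _ _ (I.mul_mem_left _ _ hDI), fun n => ?_⟩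
  have hn : W (n % m) (b (n / m)) = b n := by rw [hW, Nat.div_add_mod]
  have hlt : n % m < m := Nat.mod_lt _ hm
  rw [sum_apply, Finset.sum_eq_single_of_mem (n % m) (by simpa using hlt)]
  · have h1 : star (W (n % m)) (b n) = b (n / m) := by
      conv_lhs => rw [← hn]
      rw [← mul_apply_eq_comp, hW1, one_apply_eq_self]
    rw [mul_apply_eq_comp, mul_apply_eq_comp, h1, hD, map_smul, hn]
    rfl
  · intro r hr hne
    have h1 : star (W r) (b n) = 0 := by
      conv_lhs => rw [← hn]
      rw [← mul_apply_eq_comp, hW0 r (by simpa using hr) _ hlt hne, zero_apply]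
    rw [mul_apply_eq_comp, mul_apply_eq_comp, h1, map_zero, map_zero]

/-- The `n`-th vector is chosen orthogonal to all earlier `e i` and `T* T (e i)`. These are `2 n`
constraints, whence the index `2 * n`. -/
theorem exists_orthonormal_sNum_le (hH : ¬ FiniteDimensional ℂ H) (T : BH H) :
    ∃ e : ℕ → H, Orthonormal ℂ e ∧ (Pairwise fun i j => inner ℂ (T (e i)) (T (e j)) = 0) ∧
      ∀ n, sNum T (2 * n) ≤ 2 * ‖T (e n)‖ := by
  have step : ∀ (n : ℕ) (g : Fin n → H), ∃ y : H, ‖y‖ = 1 ∧ (∀ i, inner ℂ (g i) y = 0) ∧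
      (∀ i, inner ℂ (T (g i)) (T y) = 0) ∧ sNum T (2 * n) ≤ 2 * ‖T y‖ := by
    intro n g
    let v : Fin n ⊕ Fin n → H := Sum.elim g (fun i => star T (T (g i)))
    have hv : Module.finrank ℂ (Submodule.span ℂ (Set.range v)) ≤ 2 * n := by
      refine (finrank_range_le_card v).trans ?_
      simp [two_mul]
    have : FiniteDimensional ℂ (Submodule.span ℂ (Set.range v)) :=
      FiniteDimensional.span_of_finite ℂ (Set.finite_range v)
    obtain ⟨y, hy, hy1, hyT⟩ := exists_unit_orthogonal hH T _ hv
    have horth : ∀ i, inner ℂ (v i) y = 0 := fun i =>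
      Submodule.inner_right_of_mem_orthogonal
          (Submodule.subset_span (Set.mem_range_self i)) hy
    refine ⟨y, hy1, fun i => horth (Sum.inl i), fun i => ?_, hyT⟩
    have := horth (Sum.inr i)
    change inner ℂ (star T (T (g i))) y = 0 at this
    rwa [ContinuousLinearMap.star_eq_adjoint,
      ContinuousLinearMap.adjoint_inner_left] at this
  obtain ⟨e, he⟩ := exists_seq_of_forall_fin (α := H) step
  refine ⟨e, ⟨fun n => (he n).1, fun i j hij => ?_⟩, fun i j hij => ?_, fun n => (he n).2.2.2⟩
  · rcases hij.lt_or_gt with h | h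
    · exact (he j).2.1 ⟨i, h⟩
    · exact inner_eq_zero_symm.1 ((he i).2.1 ⟨j, h⟩)
  · rcases hij.lt_or_gt with h | h
    · exact (he j).2.2.1 ⟨i, h⟩
    · exact inner_eq_zero_symm.1 ((he i).2.2.1 ⟨j, h⟩)

/-- One half of Calkin's theorem, for noncompact `T` as well. The loss of index from `n` to `2 * n`
is repaired by a 2-fold ampliation, since `2 * (n / 2) ≤ n`. -/
theorem diagMem_sNum (hH : ¬ FiniteDimensional ℂ H) {I : TwoSidedIdeal (BH H)} {T : BH H}
    (hT : T ∈ I) : DiagMem b I (sNum T) := by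
  obtain ⟨e, he, hTe, hs⟩ := exists_orthonormal_sNum_le hH T
  obtain ⟨V, hV, -⟩ := exists_isometry_of_orthonormal b he
  have hVb : ∀ n, (T * V) (b n) = T (e n) := fun n => by rw [mul_apply_eq_comp, hV]
  have h1 : DiagMem b I (fun n => sNum T (2 * n)) := by
    refine .of_apply (I.mul_mem_right T V hT) ?_ zero_le_two fun n => ?_
    · simp only [hVb]; exact hTe
    · rw [hVb, abs_of_nonneg (sNum_nonneg _ _)]; exact hs n
  refine (h1.ampliation zero_lt_two).mono zero_le_one fun n => ?_
  rw [one_mul, abs_of_nonneg (sNum_nonneg _ _), Subideal.ampliation,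
    abs_of_nonneg (sNum_nonneg _ _)]
  exact sNum_antitone T (by omega)

end Operators

end Subideal

namespace Subideal

/-! ### Compact operators and the converse half of Calkin's theorem -/

variable {H : Type*} [NormedAddCommGroup H] [InnerProductSpace ℂ H] [CompleteSpace H]

theorem isCompactOperator_of_sNum_tendsto {T : BH H}
    (hT : Tendsto (sNum T) atTop (nhds 0)) : IsCompactOperator T := by
  have h1 : ∀ n : ℕ, ∃ F : BH H, LinearMap.rank (F : H →ₗ[ℂ] H) ≤ (n : Cardinal) ∧
      ‖T - F‖ < sNum T n + 1 / ((n : ℝ) + 1) := fun n => exists_norm_sub_lt T n (by positivity)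
  choose F hF hTF using h1
  refine isCompactOperator_of_tendsto (F := F) (l := atTop) ?_ (Eventually.of_forall fun n => ?_)
  · rw [tendsto_iff_norm_sub_tendsto_zero]
    refine squeeze_zero (fun _ => norm_nonneg _) (fun n => ?_)
      (by simpa only [add_zero] using hT.add tendsto_one_div_add_atTop_nhds_zero_nat)
    rw [norm_sub_rev]
    exact (hTF n).le
  · have : FiniteDimensional ℂ (LinearMap.range (F n : H →ₗ[ℂ] H)) :=
      Module.rank_lt_aleph0_iff.1 (lt_of_le_of_lt (hF n) Cardinal.natCast_lt_aleph0)
    have : ProperSpace (LinearMap.range (F n : H →ₗ[ℂ] H)) := FiniteDimensional.proper ℂ _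
    let G : H →L[ℂ] LinearMap.range (F n : H →ₗ[ℂ] H) :=
      (F n).codRestrict _ fun x => ⟨x, rfl⟩
    have hG : IsCompactOperator G :=
      isCompactOperator_of_locallyCompactSpace_dom G
    exact hG.clm_comp (LinearMap.range (F n : H →ₗ[ℂ] H)).subtypeL

/-- A compact operator attains its norm on the orthogonal complement of a finite-dimensional
subspace which reduces `T* T`, at an eigenvector of `T* T`. -/
theorem exists_singular_vector (hH : ¬ FiniteDimensional ℂ H) {T : BH H}
    (hT : IsCompactOperator T) (M : Submodule ℂ H) [FiniteDimensional ℂ M]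
    (hM : ∀ x ∈ M, (star T * T) x ∈ M) :
    ∃ y ∈ Mᗮ, ‖y‖ = 1 ∧ (∃ c : ℂ, (star T * T) y = c • y) ∧
      ∀ x ∈ Mᗮ, ‖T x‖ ≤ ‖T y‖ * ‖x‖ := by
  set P : BH H := Mᗮ.starProjection with hP
  have hPmem : ∀ x, P x ∈ Mᗮ := fun x => Mᗮ.starProjection_apply_mem x
  have hPid : ∀ x ∈ Mᗮ, P x = x := fun x hx => Submodule.starProjection_eq_self_iff.2 hx
  have hPs : star P = P := isSelfAdjoint_starProjection Mᗮ
  have hinv : ∀ x ∈ Mᗮ, (star T * T) x ∈ Mᗮ := by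
    intro x hx
    rw [Submodule.mem_orthogonal]
    intro u hu
    have h1 := Submodule.inner_right_of_mem_orthogonal (hM u hu) hx
    have h2 : star (star T * T) = star T * T := by rw [star_mul, star_star]
    rwa [← h2, ContinuousLinearMap.star_eq_adjoint (star T * T),
      ContinuousLinearMap.adjoint_inner_left] at h1
  set A : BH H := T * P with hA
  have hAx : ∀ x ∈ Mᗮ, A x = T x := fun x hx => by rw [hA, mul_apply_eq_comp, hPid x hx]
  rcases eq_or_ne A 0 with hA0 | hA0
  · obtain ⟨y, hy, hy1⟩ := exists_unit_mem_orthogonal hH M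
    have h0 : ∀ x ∈ Mᗮ, T x = 0 := fun x hx => by rw [← hAx x hx, hA0, zero_apply]
    refine ⟨y, hy, hy1, ⟨0, ?_⟩, fun x hx => ?_⟩
    · rw [mul_apply_eq_comp, h0 y hy, map_zero, zero_smul]
    · rw [h0 x hx, norm_zero]; positivity
  set C : BH H := star A * A with hC
  have hCn : ‖C‖ = ‖A‖ * ‖A‖ := CStarRing.norm_star_mul_self
  have hCne : ‖C‖ ≠ 0 := by rw [hCn]; simpa using hA0
  have hnt : Nontrivial (BH H) := ⟨A, 0, hA0⟩
  have hCc : IsCompactOperator C := by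
    have : IsCompactOperator A := hT.comp_clm P
    exact this.clm_comp (star A)
  -- The norm of a positive operator is in its spectrum; compactness makes this nonzero point an
  -- eigenvalue. An eigenvector lies in the range of `P`, that is, in `Mᗮ`.
  have hspec : (‖C‖ : ℂ) ∈ spectrum ℂ C := by
    have := CStarAlgebra.norm_mem_spectrum_of_nonneg (a := C) (star_mul_self_nonneg A)
    simpa using spectrum.algebraMap_mem ℂ this
  obtain ⟨v, hv⟩ := ((hCc.hasEigenvalue_iff_mem_spectrum
    (by exact_mod_cast hCne)).2 hspec).exists_hasEigenvector
  have hv1 : C v = (‖C‖ : ℂ) • v := hv.apply_eq_smul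
  have hv0 : v ≠ 0 := hv.2
  have hCP : C = P * (star T * T) * P := by rw [hC, hA, star_mul, hPs]; noncomm_ring
  have hvM : v ∈ Mᗮ := by
    have h1 : C v ∈ Mᗮ := by rw [hCP]; exact hPmem _
    rw [hv1] at h1
    exact (Submodule.smul_mem_iff _ (by exact_mod_cast hCne)).1 h1
  have hTv : (star T * T) v = (‖C‖ : ℂ) • v := by
    have h1 : C v = P ((star T * T) (P v)) := by rw [hCP]; rfl
    rw [← hv1, h1, hPid v hvM, hPid _ (hinv v hvM)]
  have hTn : ‖T v‖ = ‖A‖ * ‖v‖ := by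
    rw [← sq_eq_sq₀ (norm_nonneg _) (by positivity), mul_pow, sq ‖A‖, ← hCn]
    have h1 : inner ℂ ((star T * T) v) v = inner ℂ (T v) (T v) := by
      rw [mul_apply_eq_comp, ContinuousLinearMap.star_eq_adjoint,
        ContinuousLinearMap.adjoint_inner_left]
    rw [hTv, inner_smul_left, inner_self_eq_norm_sq_to_K, inner_self_eq_norm_sq_to_K,
      Complex.conj_ofReal] at h1
    have h2 : ((‖T v‖ ^ 2 : ℝ) : ℂ) = ((‖C‖ * ‖v‖ ^ 2 : ℝ) : ℂ) := by
      push_cast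
      exact h1.symm
    exact Complex.ofReal_injective h2
  have hvn : ‖v‖ ≠ 0 := norm_ne_zero_iff.2 hv0
  refine ⟨((‖v‖⁻¹ : ℝ) : ℂ) • v, Submodule.smul_mem _ _ hvM, ?_, ⟨‖C‖, ?_⟩, fun x hx => ?_⟩
  · rw [norm_smul, Complex.norm_real, norm_inv, norm_norm, inv_mul_cancel₀ hvn]
  · rw [map_smul, hTv, smul_comm]
  · rw [map_smul, norm_smul, Complex.norm_real, norm_inv, norm_norm, hTn, mul_comm ‖A‖,
      inv_mul_cancel_left₀ hvn, ← hAx x hx]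
    exact A.le_opNorm x

theorem exists_singular_vectors (hH : ¬ FiniteDimensional ℂ H) {T : BH H}
    (hT : IsCompactOperator T) :
    ∃ e : ℕ → H, Orthonormal ℂ e ∧ (Pairwise fun i j => inner ℂ (T (e i)) (T (e j)) = 0) ∧
      ∀ n x, (∀ i < n, inner ℂ (e i) x = 0) → ‖T x‖ ≤ ‖T (e n)‖ * ‖x‖ := by
  -- The eigenvector hypothesis sits inside the existential so that the recursion can run on
  -- arbitrary `g`, with junk value 0. Strong induction later shows that it always holds.
  have step : ∀ (n : ℕ) (g : Fin n → H), ∃ y : H,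
      (∀ i, ∃ c : ℂ, (star T * T) (g i) = c • g i) →
      ‖y‖ = 1 ∧ (∀ i, inner ℂ (g i) y = 0) ∧ (∃ c : ℂ, (star T * T) y = c • y) ∧
      ∀ x, (∀ i, inner ℂ (g i) x = 0) → ‖T x‖ ≤ ‖T y‖ * ‖x‖ := by
    intro n g
    by_cases hg : ∀ i, ∃ c : ℂ, (star T * T) (g i) = c • g i
    · have : FiniteDimensional ℂ (Submodule.span ℂ (Set.range g)) :=
        FiniteDimensional.span_of_finite ℂ (Set.finite_range g)
      have hM : ∀ x ∈ Submodule.span ℂ (Set.range g),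
          (star T * T) x ∈ Submodule.span ℂ (Set.range g) := by
        have : Submodule.span ℂ (Set.range g) ≤
            (Submodule.span ℂ (Set.range g)).comap ((star T * T : BH H) : H →ₗ[ℂ] H) := by
          rw [Submodule.span_le]
          rintro _ ⟨i, rfl⟩
          obtain ⟨c, hc⟩ := hg i
          change (star T * T) (g i) ∈ Submodule.span ℂ (Set.range g)
          rw [hc]
          exact Submodule.smul_mem _ _ (Submodule.subset_span ⟨i, rfl⟩)
        exact this
      obtain ⟨y, hy, hy1, hyc, hyT⟩ := exists_singular_vector hH hT _ hM
      refine ⟨y, fun _ => ⟨hy1, fun i => ?_, hyc, fun x hx => hyT x ?_⟩⟩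
      · exact Submodule.inner_right_of_mem_orthogonal
          (Submodule.subset_span (Set.mem_range_self i)) hy
      · have : Submodule.span ℂ (Set.range g) ≤ (Submodule.span ℂ {x})ᗮ := by
          rw [Submodule.span_le]
          rintro _ ⟨i, rfl⟩
          exact Submodule.mem_orthogonal_singleton_iff_inner_left.2 (hx i)
        rw [Submodule.le_orthogonal_iff_le_orthogonal] at this
        exact this (Submodule.mem_span_singleton_self x)
    · exact ⟨0, fun h => absurd h hg⟩
  obtain ⟨e, he⟩ := exists_seq_of_forall_fin (α := H) step
  have heig : ∀ n, ∃ c : ℂ, (star T * T) (e n) = c • e n := by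
    intro n
    induction n using Nat.strong_induction_on with
    | _ n ih => exact (he n fun i => ih i i.2).2.2.1
  have he' := fun n => he n fun i => heig i
  have horth : ∀ i j, i ≠ j → inner ℂ (e i) (e j) = 0 := by
    intro i j hij
    rcases hij.lt_or_gt with h | h
    · exact (he' j).2.1 ⟨i, h⟩
    · exact inner_eq_zero_symm.1 ((he' i).2.1 ⟨j, h⟩)
  refine ⟨e, ⟨fun n => (he' n).1, horth⟩, fun i j hij => ?_,
    fun n x hx => (he' n).2.2.2 x fun i => hx i i.2⟩
  obtain ⟨c, hc⟩ := heig i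
  rw [← ContinuousLinearMap.adjoint_inner_left, ← ContinuousLinearMap.star_eq_adjoint,
    ← mul_apply_eq_comp, hc, inner_smul_left, horth i j hij, mul_zero]

/-- Calkin's theorem: an operator belongs to an ideal containing the diagonal operator of its
s-numbers. -/
theorem mem_of_diagMem_sNum {b : HilbertBasis ℕ ℂ H} (hH : ¬ FiniteDimensional ℂ H)
    {I : TwoSidedIdeal (BH H)} {T : BH H} (hT : DiagMem b I (sNum T)) : T ∈ I := by
  obtain ⟨D, hDI, hD⟩ := hT
  -- If the s-numbers stay away from 0, the diagonal operator is bounded below and the ideal is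
  -- everything; otherwise they tend to 0 and `T` is compact.
  by_cases hlim : ∃ δ > 0, ∀ n, δ ≤ sNum T n
  · obtain ⟨δ, hδ, hs⟩ := hlim
    have h1 : (1 : BH H) ∈ I := by
      refine mem_of_norm_basis_le b hDI (fun i j h => b.orthonormal.2 h) (diag_orthogonal hD)
        (c := δ⁻¹) (by positivity) fun n => ?_
      rw [diag_norm hD, one_apply_eq_self, b.orthonormal.1, abs_of_nonneg (sNum_nonneg _ _),
        ← div_eq_inv_mul, one_le_div hδ]
      exact hs n
    simpa using I.mul_mem_left T 1 h1
  push Not at hlim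
  have htend : Tendsto (sNum T) atTop (nhds 0) := by
    rw [Metric.tendsto_atTop]
    intro ε hε
    obtain ⟨n, hn⟩ := hlim ε hε
    refine ⟨n, fun m hm => ?_⟩
    rw [Real.dist_eq, sub_zero, abs_of_nonneg (sNum_nonneg _ _)]
    exact (sNum_antitone T hm).trans_lt hn
  obtain ⟨e, he, hTe, hmax⟩ := exists_singular_vectors hH (isCompactOperator_of_sNum_tendsto htend)
  have hle : ∀ n, ‖T (e n)‖ ≤ sNum T n := by
    refine fun n => le_sNum_of_orthogonal he hTe (norm_nonneg _) fun i hi => ?_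
    have := hmax i (e n) fun j hj => he.2 (by omega)
    rwa [he.1, mul_one] at this
  obtain ⟨V, hV, hV1⟩ := exists_isometry_of_orthonormal b he
  refine mem_of_norm_le (B := D * star V) (c := 1) (I.mul_mem_right _ _ hDI) fun x => ?_
  set z := star V x with hz
  have hTV : ∀ n, (T * V) (b n) = T (e n) := fun n => by rw [mul_apply_eq_comp, hV]
  -- The vector `x - V V* x` is orthogonal to every `e i`, so its image has norm at most `sNum T n *
  -- ‖x - V z‖` for every `n`.
  have h0 : T (x - V z) = 0 := by
    have horth : ∀ i, inner ℂ (e i) (x - V z) = 0 := by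
      intro i
      rw [← hV, ← ContinuousLinearMap.adjoint_inner_right, map_sub,
        ← ContinuousLinearMap.star_eq_adjoint, ← mul_apply_eq_comp (star V) V, hV1,
        one_apply_eq_self, sub_self, inner_zero_right]
    have hlim0 : Tendsto (fun n => sNum T n * ‖x - V z‖) atTop (nhds 0) := by
      simpa using htend.mul_const ‖x - V z‖
    have : ‖T (x - V z)‖ ≤ 0 := ge_of_tendsto' hlim0 fun n =>
      (hmax n _ fun i _ => horth i).trans
        (mul_le_mul_of_nonneg_right (hle n) (norm_nonneg _))
    exact norm_le_zero_iff.1 this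
  have h1 : T x = (T * V) z := by
    rw [mul_apply_eq_comp]
    rwa [map_sub, sub_eq_zero] at h0
  rw [h1, mul_apply_eq_comp]
  refine norm_apply_le_of_basis b (L := T * V) (L' := D) ?_ (diag_orthogonal hD) zero_le_one
    (fun n => ?_) z
  · simp only [hTV]; exact hTe
  · rw [hTV, diag_norm hD, one_mul, abs_of_nonneg (sNum_nonneg _ _)]
    exact hle n

end Subideal

namespace Subideal

/-! ### Sandwich sums with coefficients in J -/

section Algebraic

variable {R : Type*} [Ring R] {N : ℕ} {S : Fin N → R} {J : TwoSidedIdeal R}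

/-- `x` is a finite sum of products `a * S k * b` with `a, b ∈ J`. -/
def IsSandwichSum (J : TwoSidedIdeal R) (S : Fin N → R) (x : R) : Prop :=
  ∃ (n : Fin N → ℕ) (A B : (k : Fin N) → Fin (n k) → R),
    (∀ k i, A k i ∈ J ∧ B k i ∈ J) ∧ x = ∑ k, ∑ i, A k i * S k * B k i

theorem IsSandwichSum.add {x y : R} (hx : IsSandwichSum J S x) (hy : IsSandwichSum J S y) :
    IsSandwichSum J S (x + y) := by
  obtain ⟨n, A, B, h, rfl⟩ := hx
  obtain ⟨n', A', B', h', rfl⟩ := hy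
  refine ⟨fun k => n k + n' k, fun k => Fin.append (A k) (A' k),
    fun k => Fin.append (B k) (B' k), fun k i => ?_, ?_⟩
  · refine Fin.addCases (fun i => ?_) (fun i => ?_) i
    · simpa using h k i
    · simpa using h' k i
  · simp [Fin.sum_univ_add, Finset.sum_add_distrib]

theorem isSandwichSum_mul_mul {a b : R} (ha : a ∈ J) (hb : b ∈ J) (k : Fin N) :
    IsSandwichSum J S (a * S k * b) := by
  refine ⟨fun _ => 1, fun k' _ => if k' = k then a else 0, fun _ _ => b, fun k' _ => ⟨?_, hb⟩, ?_⟩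
  · dsimp only
    split_ifs
    exacts [ha, J.zero_mem]
  · simp

/-- The outer factors are quantified inside the induction, so that ring multipliers of `x` can be
absorbed into `a` and `b`. -/
theorem isSandwichSum_of_mem_span {x : R} (hx : x ∈ TwoSidedIdeal.span (Set.range S)) :
    ∀ a ∈ J, ∀ b ∈ J, IsSandwichSum J S (a * x * b) := by
  induction hx using TwoSidedIdeal.span_induction with
  | mem x h =>
    obtain ⟨k, rfl⟩ := h
    exact fun a ha b hb => isSandwichSum_mul_mul ha hb k
  | zero => exact fun a ha b hb => ⟨fun _ => 0, fun _ _ => 0, fun _ _ => 0, by simp [J.zero_mem],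
      by simp⟩
  | add x y _ _ hx hy =>
    intro a ha b hb
    rw [mul_add, add_mul]
    exact (hx a ha b hb).add (hy a ha b hb)
  | neg x _ hx =>
    intro a ha b hb
    rw [mul_neg, ← neg_mul]
    exact hx _ (J.neg_mem ha) b hb
  | left_absorb c x _ hx =>
    intro a ha b hb
    rw [← mul_assoc]
    exact hx _ (J.mul_mem_right _ _ ha) b hb
  | right_absorb c x _ hx =>
    intro a ha b hb
    rw [← mul_assoc, mul_assoc _ c b]
    exact hx a ha _ (J.mul_mem_left _ _ hb)

theorem isSandwichSum_of_mem_idealMul {x : R}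
    (hx : x ∈ idealMul J (idealMul (TwoSidedIdeal.span (Set.range S)) J)) :
    IsSandwichSum J S x := by
  refine idealMul_induction (fun a ha y hy => ?_) (fun _ _ => .add) hx
  refine idealMul_induction (p := fun y => IsSandwichSum J S (a * y)) (fun z hz b hb => ?_)
    (fun u v hu hv => ?_) hy
  · rw [← mul_assoc]
    exact isSandwichSum_of_mem_span hz a ha b hb
  · rw [mul_add]
    exact hu.add hv

theorem IsSandwichSum.mem_idealMul {x : R} (hx : IsSandwichSum J S x) :
    x ∈ idealMul J (TwoSidedIdeal.span (Set.range S)) := by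
  obtain ⟨n, A, B, h, rfl⟩ := hx
  exact sum_mem fun k _ => sum_mem fun i _ => TwoSidedIdeal.mul_mem_right _ _ _
    (mul_mem_idealMul (h k i).1 (TwoSidedIdeal.subset_span ⟨k, rfl⟩))

theorem span_subset_jSpan (h : ∀ j, IsSandwichSum J S (S j)) {x : R}
    (hx : x ∈ TwoSidedIdeal.span (Set.range S)) : x ∈ jSpan J (Set.range S) := by
  have key : ∀ c d : R, c * x * d ∈ jSpan J (Set.range S) := by
    induction hx using TwoSidedIdeal.span_induction with
    | mem x hx =>
      obtain ⟨j, rfl⟩ := hx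
      intro c d
      obtain ⟨n, A, B, hAB, hj⟩ := h j
      rw [hj, Finset.mul_sum, Finset.sum_mul]
      refine sum_mem fun k _ => ?_
      rw [Finset.mul_sum, Finset.sum_mul]
      refine sum_mem fun i _ => ?_
      have : c * (A k i * S k * B k i) * d = (c * A k i) * S k * (B k i * d) := by
        simp only [mul_assoc]
      rw [this]
      exact mul_mul_mem_jSpan (J.mul_mem_left _ _ (hAB k i).1) (J.mul_mem_right _ _ (hAB k i).2)
        ⟨k, rfl⟩
    | zero => intro c d; simp
    | add x y _ _ hx hy =>
      intro c d
      rw [mul_add, add_mul]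
      exact AddSubgroup.add_mem _ (hx c d) (hy c d)
    | neg x _ hx =>
      intro c d
      rw [mul_neg, neg_mul]
      exact AddSubgroup.neg_mem _ (hx c d)
    | left_absorb a x _ hx =>
      intro c d
      rw [← mul_assoc]
      exact hx _ d
    | right_absorb a x _ hx =>
      intro c d
      rw [← mul_assoc, mul_assoc _ a d]
      exact hx c _
  simpa using key 1 1

/-- The sandwich hypothesis closes the chain of inclusions from `jSpan` through the real and complex
versions to the full ideal and back. -/
theorem jSpan_eq_of_sandwich [Algebra ℂ R] (hS : ∀ j, S j ∈ J)
    (h : ∀ j, IsSandwichSum J S (S j)) :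
    jSpan J (Set.range S) = jSpanOver ℝ J (Set.range S) ∧
      jSpanOver ℝ J (Set.range S) = jSpanOver ℂ J (Set.range S) ∧
      (jSpanOver ℂ J (Set.range S) : Set R) = (TwoSidedIdeal.span (Set.range S) : Set R) := by
  have hIJ : TwoSidedIdeal.span (Set.range S) ≤ J :=
    TwoSidedIdeal.span_le.2 (by rintro _ ⟨j, rfl⟩; exact hS j)
  have h1 : jSpan J (Set.range S) ≤ jSpanOver ℝ J (Set.range S) := jSpan_le_jSpanOver ℝ _ _
  have h2 := jSpanOver_real_le_complex J (Set.range S)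
  have h3 : jSpanOver ℂ J (Set.range S) ≤
      (idealSubmodule (TwoSidedIdeal.span (Set.range S))).toAddSubgroup :=
    jSpanOver_le (isJIdeal_of_ideal hIJ) (fun c x hx => smul_mem_of_mem _ c hx)
      TwoSidedIdeal.subset_span
  have h4 : (idealSubmodule (TwoSidedIdeal.span (Set.range S))).toAddSubgroup ≤
      jSpan J (Set.range S) := fun x hx => span_subset_jSpan h hx
  refine ⟨le_antisymm h1 ((h2.trans h3).trans h4), le_antisymm h2 ((h3.trans h4).trans h1), ?_⟩
  exact congrArg (SetLike.coe) (le_antisymm h3 ((h4.trans h1).trans h2))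

end Algebraic

/-! ### Softness and s-number domination -/

section Operators

theorem exists_sNum_le_of_mem_span {H : Type*} [NormedAddCommGroup H] [InnerProductSpace ℂ H]
    {K L : BH H} (hL : L ∈ TwoSidedIdeal.span {K}) :
    ∃ C, 0 ≤ C ∧ ∃ m, 0 < m ∧ ∀ n, sNum L n ≤ C * sNum K (n / m) := by
  have left : ∀ a x : BH H, (∃ C, 0 ≤ C ∧ ∃ m, 0 < m ∧ ∀ n, sNum x n ≤ C * sNum K (n / m)) →
      ∃ C, 0 ≤ C ∧ ∃ m, 0 < m ∧ ∀ n, sNum (a * x) n ≤ C * sNum K (n / m) := by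
    rintro a x ⟨C, hC, m, hm, h⟩
    refine ⟨‖a‖ * C, by positivity, m, hm, fun n => ?_⟩
    have := sNum_mul_le a x 0 n
    rw [zero_add, sNum_zero] at this
    rw [mul_assoc]
    exact this.trans (mul_le_mul_of_nonneg_left (h n) (norm_nonneg _))
  induction hL using TwoSidedIdeal.span_induction with
  | mem x hx =>
    rw [Set.mem_singleton_iff.1 hx]
    exact ⟨1, zero_le_one, 1, one_pos, fun n => by simp⟩
  | zero => exact ⟨0, le_rfl, 1, one_pos, fun n => by simpa using sNum_le_norm (0 : BH H) n⟩
  | add x y _ _ hx hy =>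
    obtain ⟨C, hC, m, hm, h⟩ := hx
    obtain ⟨C', hC', m', hm', h'⟩ := hy
    -- The factor 2 comes from splitting `n` into two halves in `sNum_add_le`; `m + m'` exceeds both
    -- ampliation orders.
    refine ⟨C + C', by positivity, 2 * (m + m'), by positivity, fun n => ?_⟩
    have h1 : sNum (x + y) n ≤ sNum x (n / 2) + sNum y (n / 2) :=
      (sNum_antitone _ (by omega)).trans (sNum_add_le x y (n / 2) (n / 2))
    have h2 : sNum K (n / 2 / m) ≤ sNum K (n / (2 * (m + m'))) := sNum_antitone _ (by
      rw [← Nat.div_div_eq_div_mul]; exact Nat.div_le_div_left (by omega) hm)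
    have h3 : sNum K (n / 2 / m') ≤ sNum K (n / (2 * (m + m'))) := sNum_antitone _ (by
      rw [← Nat.div_div_eq_div_mul]; exact Nat.div_le_div_left (by omega) hm')
    have h4 := (h (n / 2)).trans (mul_le_mul_of_nonneg_left h2 hC)
    have h5 := (h' (n / 2)).trans (mul_le_mul_of_nonneg_left h3 hC')
    rw [add_mul]
    linarith
  | neg x _ hx =>
    rw [← neg_one_mul]
    exact left _ _ hx
  | left_absorb a x _ hx => exact left _ _ hx
  | right_absorb a x _ hx =>
    obtain ⟨C, hC, m, hm, h⟩ := hx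
    refine ⟨C * ‖a‖, by positivity, m, hm, fun n => ?_⟩
    have := sNum_mul_le x a n 0
    rw [add_zero, sNum_zero] at this
    rw [mul_right_comm]
    exact this.trans (mul_le_mul_of_nonneg_right (h n) (norm_nonneg _))

variable {H : Type*} [NormedAddCommGroup H] [InnerProductSpace ℂ H] [CompleteSpace H]
  {N : ℕ} {S : Fin N → BH H} {J : TwoSidedIdeal (BH H)}

/-- If a `J`-ideal between the smallest `J`-ideal and the smallest linear `J`-ideal containing the
`S j` is a `B(H)`-ideal, then the `B(H)`-ideal generated by the `S j` is `J`-soft. -/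
theorem span_le_idealMul_of_isFullIdeal (b : HilbertBasis ℕ ℂ H) (hS : ∀ j, S j ∈ J)
    {X : AddSubgroup (BH H)} (h₁ : jSpan J (Set.range S) ≤ X)
    (h₂ : X ≤ jSpanOver ℂ J (Set.range S)) (hX : IsFullIdeal X) :
    TwoSidedIdeal.span (Set.range S) ≤ idealMul J (TwoSidedIdeal.span (Set.range S)) := by
  set I := TwoSidedIdeal.span (Set.range S) with hI
  set Q := idealMul J I with hQ
  obtain ⟨K, hK⟩ := hX
  have hSI : Set.range S ⊆ I := TwoSidedIdeal.subset_span
  have hIK : I ≤ K := TwoSidedIdeal.span_le.2 (by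
    rw [hK]; exact (subset_jSpan J _).trans h₁)
  have hIJ : I ≤ J := TwoSidedIdeal.span_le.2 (by rintro _ ⟨j, rfl⟩; exact hS j)
  have hle : Submodule.span ℂ (Set.range S) ⊔ idealSubmodule Q ≤ idealSubmodule I :=
    sup_le (Submodule.span_le.2 hSI) (idealMul_le_right J I)
  -- Multiplying an element of `I` by `J` on either side lands in `Q`, because `J I = I J`.
  have hJX : IsJIdeal J (Submodule.span ℂ (Set.range S) ⊔ idealSubmodule Q).toAddSubgroup := by
    refine ⟨fun x hx => hIJ (hle hx), fun a ha x hx => ?_, fun a ha x hx => ?_⟩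
    · exact Submodule.mem_sup_right (mul_mem_idealMul ha (hle hx))
    · refine Submodule.mem_sup_right ?_
      rw [mem_idealSubmodule, hQ, idealMul_comm]
      exact mul_mem_idealMul (hle hx) ha
  have hfin : ∀ x ∈ I, x ∈ Submodule.span ℂ (Set.range S) ⊔ idealSubmodule Q := by
    intro x hx
    have hxX : x ∈ (X : Set (BH H)) := hK ▸ hIK hx
    exact jSpanOver_le hJX (fun c x hx => Submodule.smul_mem
        (Submodule.span ℂ (Set.range S) ⊔ idealSubmodule Q) c hx)
      (fun y hy => Submodule.mem_sup_left (Submodule.subset_span hy)) (h₂ hxX)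
  obtain ⟨W, -, hW1, hW0⟩ := exists_shifts b 2 zero_lt_two
  exact ideal_le_of_finite_codim (hW1 0) (hW1 1) (hW0 0 zero_lt_two 1 one_lt_two zero_ne_one)
    (Set.finite_range S) hfin

/-- The majorant from `J` is kept as a diagonal sequence, not as `sNum T`, because such sequences
can be added within `J`. -/
theorem exists_sNum_le_of_mem_idealMul (b : HilbertBasis ℕ ℂ H) (hH : ¬ FiniteDimensional ℂ H)
    {K X : BH H} (hX : X ∈ idealMul J (TwoSidedIdeal.span {K})) :
    ∃ ξ, DiagMem b J ξ ∧ Antitone ξ ∧ (∀ n, 0 ≤ ξ n) ∧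
      ∃ m, 0 < m ∧ ∀ n, sNum X n ≤ sNum K (n / m) * ξ n := by
  have amp : ∀ ξ : ℕ → ℝ, Antitone ξ → Antitone (ampliation 2 ξ) := fun ξ h n n' hn =>
    h (Nat.div_le_div_right hn)
  refine idealMul_induction (p := fun X => ∃ ξ, DiagMem b J ξ ∧ Antitone ξ ∧ (∀ n, 0 ≤ ξ n) ∧
      ∃ m, 0 < m ∧ ∀ n, sNum X n ≤ sNum K (n / m) * ξ n) ?_ ?_ hX
  · intro A hA L hL
    obtain ⟨C, hC, m, hm, h⟩ := exists_sNum_le_of_mem_span hL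
    have h1 : DiagMem b J (fun n => C * sNum A n) := by
      refine (diagMem_sNum hH hA).mono hC fun n => ?_
      rw [abs_mul, abs_of_nonneg hC]
    refine ⟨_, h1.ampliation zero_lt_two, amp _ fun n n' hn =>
      mul_le_mul_of_nonneg_left (sNum_antitone A hn) hC,
      fun n => mul_nonneg hC (sNum_nonneg _ _), 2 * m, by positivity, fun n => ?_⟩
    have h2 : sNum (A * L) n ≤ sNum A (n / 2) * sNum L (n / 2) :=
      (sNum_antitone _ (by omega)).trans (sNum_mul_le A L (n / 2) (n / 2))
    rw [← Nat.div_div_eq_div_mul]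
    calc sNum (A * L) n ≤ sNum A (n / 2) * (C * sNum K (n / 2 / m)) :=
          h2.trans (mul_le_mul_of_nonneg_left (h _) (sNum_nonneg _ _))
      _ = sNum K (n / 2 / m) * (C * sNum A (n / 2)) := by ring
  · rintro X Y ⟨ξ, hξ, hξa, hξ0, m, hm, h⟩ ⟨η, hη, hηa, hη0, m', hm', h'⟩
    refine ⟨_, (hξ.add hη).ampliation zero_lt_two, amp _ (hξa.add hηa),
      fun n => add_nonneg (hξ0 _) (hη0 _), 2 * (m + m'), by positivity, fun n => ?_⟩
    have h1 : sNum (X + Y) n ≤ sNum X (n / 2) + sNum Y (n / 2) :=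
      (sNum_antitone _ (by omega)).trans (sNum_add_le X Y (n / 2) (n / 2))
    have h2 : sNum K (n / 2 / m) ≤ sNum K (n / (2 * (m + m'))) := sNum_antitone _ (by
      rw [← Nat.div_div_eq_div_mul]; exact Nat.div_le_div_left (by omega) hm)
    have h3 : sNum K (n / 2 / m') ≤ sNum K (n / (2 * (m + m'))) := sNum_antitone _ (by
      rw [← Nat.div_div_eq_div_mul]; exact Nat.div_le_div_left (by omega) hm')
    have h4 := (h (n / 2)).trans (mul_le_mul_of_nonneg_right h2 (hξ0 _))
    have h5 := (h' (n / 2)).trans (mul_le_mul_of_nonneg_right h3 (hη0 _))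
    change _ ≤ _ * (ξ (n / 2) + η (n / 2))
    rw [mul_add]
    linarith

theorem exists_common_isBigO (b : HilbertBasis ℕ ℂ H) (hH : ¬ FiniteDimensional ℂ H) {K : BH H}
    (h : ∀ j, S j ∈ idealMul J (TwoSidedIdeal.span {K})) :
    ∃ T ∈ J, ∃ m : ℕ, 1 ≤ m ∧ ∀ j,
      sNum (S j) =O[atTop] fun n => ampliation m (sNum K) n * sNum T n := by
  choose ξ hξ hξa hξ0 m hm hs using fun j => exists_sNum_le_of_mem_idealMul b hH (h j)
  obtain ⟨T, hT, hle⟩ := (DiagMem.sum (s := Finset.univ) fun j _ => hξ j).exists_le_sNum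
    (fun n n' hn => by
      rw [Finset.sum_apply, Finset.sum_apply]
      exact Finset.sum_le_sum fun j _ => hξa j hn)
    (fun n => by rw [Finset.sum_apply]; exact Finset.sum_nonneg fun j _ => hξ0 j n)
  -- The extra 1 keeps the ampliation order positive when the family is empty.
  refine ⟨T, hT, ∑ j, m j + 1, by omega, fun j => IsBigO.of_bound 1 (Eventually.of_forall
    fun n => ?_)⟩
  rw [one_mul, ampliation, Real.norm_of_nonneg (sNum_nonneg _ _), Real.norm_of_nonneg
    (mul_nonneg (sNum_nonneg _ _) (sNum_nonneg _ _))]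
  refine (hs j n).trans (mul_le_mul (sNum_antitone _ (Nat.div_le_div_left ?_ (hm j)))
    (le_trans ?_ (hle n)) (hξ0 j n) (sNum_nonneg _ _))
  · exact (Finset.single_le_sum (f := m) (fun _ _ => Nat.zero_le _) (Finset.mem_univ j)).trans
      (Nat.le_succ _)
  · rw [Finset.sum_apply]
    exact Finset.single_le_sum (f := fun j => ξ j n) (fun i _ => hξ0 i n) (Finset.mem_univ j)

theorem mem_idealMul_of_isBigO (b : HilbertBasis ℕ ℂ H) (hH : ¬ FiniteDimensional ℂ H)
    {I : TwoSidedIdeal (BH H)} {A K T : BH H} (hA : A ∈ J) (hK : K ∈ I) (hT : T ∈ J)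
    (hAK : K = 0 → A = 0) {m : ℕ} (hm : 1 ≤ m)
    (h : sNum A =O[atTop] fun n => ampliation m (sNum K) n * sNum T n) :
    A ∈ idealMul J I := by
  rcases eq_or_ne K 0 with hK0 | hK0
  · rw [hAK hK0]; exact TwoSidedIdeal.zero_mem _
  obtain ⟨C, hC, hbound⟩ := h.exists_pos
  obtain ⟨n₀, hn₀⟩ := eventually_atTop.1 hbound.bound
  have hKn : 0 < ‖K‖ := norm_pos_iff.2 hK0
  -- The bound is only available for `n ≥ n₀`. Raising the order to `m + n₀` makes the first `n₀`
  -- ampliated entries equal `‖K‖ > 0`, and adding `sNum A`, allowed since `A ∈ J`, covers those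
  -- indices with constant `‖K‖⁻¹`.
  refine mem_of_diagMem_sNum hH ((((diagMem_sNum (b := b) hH hT).add (diagMem_sNum hH hA)).mul
    ((diagMem_sNum hH hK).ampliation (m := m + n₀) (by omega))).mono (c := C + ‖K‖⁻¹)
    (by positivity) fun n => ?_)
  have hA0 := sNum_nonneg A n
  have hT0 := sNum_nonneg T n
  have hk0 := sNum_nonneg K (n / (m + n₀))
  rw [Pi.mul_apply, Pi.add_apply, abs_of_nonneg hA0]
  simp only [ampliation]
  rw [abs_of_nonneg (by positivity)]
  rcases lt_or_ge n n₀ with hn | hn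
  · rw [Nat.div_eq_of_lt (by omega), sNum_zero]
    calc sNum A n = ‖K‖⁻¹ * (sNum A n * ‖K‖) := by field_simp
      _ ≤ (C + ‖K‖⁻¹) * ((sNum T n + sNum A n) * ‖K‖) := by gcongr <;> linarith
  · have h1 := hn₀ n hn
    rw [Real.norm_of_nonneg hA0, ampliation, Real.norm_of_nonneg
      (mul_nonneg (sNum_nonneg _ _) hT0)] at h1
    have h2 : sNum K (n / m) ≤ sNum K (n / (m + n₀)) :=
      sNum_antitone _ (Nat.div_le_div_left (by omega) (by omega))
    calc sNum A n ≤ C * (sNum K (n / m) * sNum T n) := h1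
      _ ≤ C * (sNum K (n / (m + n₀)) * sNum T n) := by gcongr
      _ = C * (sNum T n * sNum K (n / (m + n₀))) := by ring
      _ ≤ (C + ‖K‖⁻¹) * ((sNum T n + sNum A n) * sNum K (n / (m + n₀))) := by
        gcongr
        · exact le_add_of_nonneg_right (by positivity)
        · linarith

end Operators

end Subideal

/-! ### The equivalences and the common value -/

theorem theorem3 {H : Type*} [NormedAddCommGroup H] [InnerProductSpace ℂ H] [CompleteSpace H]
    [TopologicalSpace.SeparableSpace H] (hH : ¬ FiniteDimensional ℂ H)
    (J : TwoSidedIdeal (Subideal.BH H)) (N : ℕ) (S : Fin N → Subideal.BH H)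
    (hS : ∀ j, S j ∈ J) :
    List.TFAE
      [ -- each of the three kinds of generated `J`-ideals is a `B(H)`-ideal
        Subideal.IsFullIdeal (Subideal.jSpanOver ℂ J (Set.range S)),
        Subideal.IsFullIdeal (Subideal.jSpan J (Set.range S)),
        Subideal.IsFullIdeal (Subideal.jSpanOver ℝ J (Set.range S)),
        -- the `B(H)`-ideal generated by the `S j` is `J`-soft, in both forms
        TwoSidedIdeal.span (Set.range S) =
          Subideal.idealMul J (TwoSidedIdeal.span (Set.range S)),
        TwoSidedIdeal.span (Set.range S) =
          Subideal.idealMul (TwoSidedIdeal.span (Set.range S)) J,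
        -- each `S j` is a finite sum of terms `A * S k * B` with `A, B ∈ J`
        ∀ j, ∃ (n : Fin N → ℕ) (A B : (k : Fin N) → Fin (n k) → Subideal.BH H),
          (∀ k i, A k i ∈ J ∧ B k i ∈ J) ∧ S j = ∑ k, ∑ i, A k i * S k * B k i,
        -- the s-number condition, with `T` and `m` chosen for each `j`
        ∀ j, ∃ T ∈ J, ∃ m : ℕ, 1 ≤ m ∧
          Subideal.sNum (S j) =O[atTop] fun n =>
            Subideal.ampliation m (Subideal.sNum (∑ k, CFC.abs (S k))) n * Subideal.sNum T n,
        -- the s-number condition, with the same `T` and `m` for all `j`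
        ∃ T ∈ J, ∃ m : ℕ, 1 ≤ m ∧ ∀ j,
          Subideal.sNum (S j) =O[atTop] fun n =>
            Subideal.ampliation m (Subideal.sNum (∑ k, CFC.abs (S k))) n * Subideal.sNum T n ] ∧
    (Subideal.IsFullIdeal (Subideal.jSpanOver ℂ J (Set.range S)) ∨
      Subideal.IsFullIdeal (Subideal.jSpan J (Set.range S)) ∨
      Subideal.IsFullIdeal (Subideal.jSpanOver ℝ J (Set.range S)) →
      Subideal.jSpan J (Set.range S) = Subideal.jSpanOver ℝ J (Set.range S) ∧
      Subideal.jSpanOver ℝ J (Set.range S) = Subideal.jSpanOver ℂ J (Set.range S) ∧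
      (Subideal.jSpanOver ℂ J (Set.range S) : Set (Subideal.BH H)) =
        (TwoSidedIdeal.span (Set.range S) : Set (Subideal.BH H)) ∧
      TwoSidedIdeal.span (Set.range S) =
        TwoSidedIdeal.span {∑ k, CFC.abs (S k)}) := by
  have hsum := Subideal.span_range_eq_span_sum_abs S
  obtain ⟨b⟩ := Subideal.exists_nat_hilbertBasis hH
  have le_soft := fun X h₁ h₂ hX =>
    Subideal.span_le_idealMul_of_isFullIdeal (X := X) b hS h₁ h₂ hX
  have soft_of_le : TwoSidedIdeal.span (Set.range S) ≤
      Subideal.idealMul J (TwoSidedIdeal.span (Set.range S)) →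
      TwoSidedIdeal.span (Set.range S) =
        Subideal.idealMul J (TwoSidedIdeal.span (Set.range S)) := fun h =>
    le_antisymm h (Subideal.idealMul_le_right _ _)
  have sandwich : TwoSidedIdeal.span (Set.range S) =
      Subideal.idealMul J (TwoSidedIdeal.span (Set.range S)) →
      ∀ j, Subideal.IsSandwichSum J S (S j) := by
    intro h j
    refine Subideal.isSandwichSum_of_mem_idealMul ?_
    -- Softness is used twice, with commutativity: `I = J I = J (J I) = J (I J)`.
    rw [Subideal.idealMul_comm _ J, ← h, ← h]
    exact TwoSidedIdeal.subset_span ⟨j, rfl⟩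
  have hRC := Subideal.jSpanOver_real_le_complex J (Set.range S)
  have hR := Subideal.jSpan_le_jSpanOver ℝ J (Set.range S)
  have soft_c := fun h => soft_of_le (le_soft _ (hR.trans hRC) le_rfl h)
  have soft_z := fun h => soft_of_le (le_soft _ le_rfl (hR.trans hRC) h)
  have soft_r := fun h => soft_of_le (le_soft _ hR hRC h)
  refine ⟨?_, fun h => ?_⟩
  · tfae_have 1 → 4 := soft_c
    tfae_have 2 → 4 := soft_z
    tfae_have 3 → 4 := soft_r
    tfae_have 4 ↔ 5 := by rw [Subideal.idealMul_comm]
    tfae_have 4 → 6 := sandwich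
    tfae_have 6 → 4 := fun h => soft_of_le (TwoSidedIdeal.span_le.2 (by
      rintro _ ⟨j, rfl⟩
      exact Subideal.IsSandwichSum.mem_idealMul (h j)))
    tfae_have 6 → 1 := fun h => ⟨_, (Subideal.jSpan_eq_of_sandwich hS h).2.2.symm⟩
    tfae_have 6 → 2 := fun h => by
      obtain ⟨h1, h2, h3⟩ := Subideal.jSpan_eq_of_sandwich hS h
      exact ⟨_, by rw [h1, h2, h3]⟩
    tfae_have 6 → 3 := fun h => by
      obtain ⟨h1, h2, h3⟩ := Subideal.jSpan_eq_of_sandwich hS h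
      exact ⟨_, by rw [h2, h3]⟩
    tfae_have 4 → 8 := fun h => Subideal.exists_common_isBigO b hH fun j => by
      rw [← hsum, ← h]
      exact TwoSidedIdeal.subset_span ⟨j, rfl⟩
    tfae_have 8 → 7 := fun ⟨T, hT, m, hm, h⟩ j => ⟨T, hT, m, hm, h j⟩
    tfae_have 7 → 4 := fun h => soft_of_le (TwoSidedIdeal.span_le.2 (by
      rintro _ ⟨j, rfl⟩
      obtain ⟨T, hT, m, hm, hO⟩ := h j
      refine Subideal.mem_idealMul_of_isBigO b hH (hS j) ?_ hT (fun h0 => ?_) hm hO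
      · rw [hsum]
        exact TwoSidedIdeal.subset_span rfl
      -- If `∑ |S k| = 0`, the ideal it generates is zero and so is `S j`.
      · have hj : S j ∈ TwoSidedIdeal.span (Set.range S) := TwoSidedIdeal.subset_span ⟨j, rfl⟩
        rw [hsum, h0] at hj
        have : TwoSidedIdeal.span {(0 : Subideal.BH H)} ≤ ⊥ := TwoSidedIdeal.span_le.2 (by simp)
        exact (TwoSidedIdeal.mem_bot _).1 (this hj)))
    tfae_finish
  · have hsoft := h.elim soft_c fun h => h.elim soft_z soft_r
    obtain ⟨h1, h2, h3⟩ := Subideal.jSpan_eq_of_sandwich hS (sandwich hsoft)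
    exact ⟨h1, h2, h3, hsum⟩
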